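/- **Partitioned spaces and routes.** A partitioned space is a finite-dimensional complex Hilbert space $\mathcal H$ with a family $(\pi^k)_{k\in Z}$, $Z$ finite, of pairwise orthogonal orthogonal projectors with sum $\mathrm{id}$; tensor products are taken with index set the product and projectors $\bigotimes_i\pi_i^{k_i}$. For a relation $\lambda: Z_A\to Z_B$, put $S_\lambda=\{k:\exists l,\ k\overset{\lambda}{\sim} l\}$ and $T_\lambda=S_{\lambda^\top}$. A linear map $U:\mathcal H_A\to\mathcal H_B$ follows the route $\lambda$ if $U=\sum_{k\overset{\lambda}{\sim}l}\mu^l U\pi^k$; then $(\lambda,U)$ is a practical isometry if $U$ is isometric on $\bigoplus_{k\in S_\lambda}\pi^k\mathcal H_A$, and a practical unitary if $(\lambda,U)$ and $(\lambda^\top,U^\dagger)$ are practical isometries. The composition of $\lambda: Z_A\to Z_B$ and $\sigma: Z_B\to Z_C$ is proper for isometries if $(\lambda\circ\lambda^\top)[S_\sigma]\subseteq S_\sigma$, and proper for unitaries if moreover $(\sigma^\top\circ\sigma)[T_\lambda]\subseteq T_\lambda$. **Corelations.** A corelation $\kappa: X\to Y$ between finite sets is an equivalence relation on $X\sqcup Y$;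 corelations are composed by gluing along the middle set, generating an equivalence relation, and restricting to the outer sets. If every index $x$ has a length $l(x)\ge1$, the same for related indices, then $\kappa$ gives a relation $\bar\kappa$ between families of values $k_x\in\{1,\dots,l(x)\}$: $(k_x)_{x\in X}$ and $(k_y)_{y\in Y}$ are related iff $k_z=k_{z'}$ whenever $z\overset{\kappa}{\sim}z'$ in $X\sqcup Y$. An index-matching routed map is a pair $(\kappa,f)$ such that $f$ follows $\bar\kappa$; such pairs are composed componentwise, and properties of $(\bar\kappa,f)$ or of $\bar\kappa$ are attributed to $(\kappa,f)$ or $\kappa$. **IODAGs.** An indexed wire system is a finite set $I$ with a finite set $K_I$ of indices, a placing map $K_I\to I$ and an equivalence relation $\sim_I$ on $K_I$. An IODAG $\Gamma:I\to O$ consists of finite sets $E$ (inner edges), $N$ (nodes), $K_E$ (indices placed on $E$ by a map $K_E\to E$), maps $h:I\sqcup E\to N$ (head) and $t:E\sqcup O\to N$ (tail) that make $\Gamma$ an acyclic directed graph, and an equivalence relation $\sim_\Gamma$ on $K_I\sqcup K_E\sqcup K_O$ that restricts to $\sim_I$ and $\sim_O$. A starting point of a class $c$ of $\sim_\Gamma$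 is a node that has an element of $c$ on an outgoing wire and none on its incoming wires; endpoints are defined symmetrically. $\Gamma$ is an iso-IODAG if every class has at most one starting point, and none if it meets $K_I$; it is a uni-IODAG if moreover every class has at most one endpoint, and none if it meets $K_O$. Let $\kappa_n$ (for a node $n$, from its incoming to its outgoing indices), $\kappa_{\rm pre}:K_I\to K_I$ and $\kappa_{\rm tot}:K_I\to K_O$ be the corelations that relate two elements iff these are related by $\sim_\Gamma$. **Interpretations.** An interpretation of $\Gamma$ in practically isometric (resp. practically unitary) index-matching routed maps gives: to each index a length $\ge1$, the same for $\sim_\Gamma$-related indices; to each wire a partitioned space whose sectors are labelled by the families of values of the indices on that wire; to each node $n$ a linear map $f_n$, from the tensor product of its incoming wires' spaces to that of its outgoing wires' spaces, such that $(\kappa_n,f_n)$ is an index-matching routed map and a practical isometry (resp. practical unitary). The meaning is the index-matching routed map obtained from $(\kappa_{\rm pre},\pi^{\rm pre})$, where $\pi^{\rm pre}=\sum_{\vec k\,:\,\vec k\,\overset{\bar\kappa_{\rm pre}}{\sim}\,\vec k}\pi^{\vec k}$ on the tensor product of the input spaces, by composing it successively with $(\kappa_n,f_n)$ (in parallel with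 identities on the other wires present) for all nodes $n$, each once, in an order compatible with the graph. **Theorem.** Such an order always exists, and the following holds for every such order. If $\Gamma$ is an iso-IODAG, then all the compositions in this construction are proper for isometries and the composed corelation is $\kappa_{\rm tot}$; given an interpretation in practically isometric index-matching routed maps, its meaning (which thus has route $\kappa_{\rm tot}$) is a practical isometry. If $\Gamma$ is a uni-IODAG, then all the compositions are proper for unitaries and the composed corelation is $\kappa_{\rm tot}$; given an interpretation in practically unitary index-matching routed maps, its meaning is a practical unitary. -/

import Mathlib

open scoped TensorProduct

universe u v w

noncomputable section

/-! ### Tensor products of finite families of finite-dimensional Hilbert spaces -/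

/-- The tensor product of a family of complex vector spaces, to be equipped with the Hilbert space
structure `⟪⨂ x, ⨂ y⟫ = ∏ ⟪x i, y i⟫` (see `HTensor.inner_tprod`). -/
def HTensor {ι : Type u} (H : ι → Type v) [∀ i, NormedAddCommGroup (H i)]
    [∀ i, InnerProductSpace ℂ (H i)] : Type (max u v) :=
  ⨂[ℂ] i, H i

namespace HTensor

variable {ι : Type u} (H : ι → Type v) [∀ i, NormedAddCommGroup (H i)]
  [∀ i, InnerProductSpace ℂ (H i)]

instance instAddCommGroup : AddCommGroup (HTensor H) :=
  inferInstanceAs (AddCommGroup (⨂[ℂ] i, H i))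

instance instModule : Module ℂ (HTensor H) :=
  inferInstanceAs (Module ℂ (⨂[ℂ] i, H i))

instance instFinite [Finite ι] [∀ i, FiniteDimensional ℂ (H i)] :
    FiniteDimensional ℂ (HTensor H) :=
  inferInstanceAs (Module.Finite ℂ (⨂[ℂ] i, H i))

variable {H} in
/-- Pure tensors. -/
def tprod (x : ∀ i, H i) : HTensor H := PiTensorProduct.tprod ℂ x

/-- The product basis obtained from an orthonormal basis of each factor. -/
def basis [Finite ι] [∀ i, FiniteDimensional ℂ (H i)] :
    Module.Basis (∀ i, Fin (Module.finrank ℂ (H i))) ℂ (HTensor H) :=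
  Basis.piTensorProduct (R := ℂ) (fun i => (stdOrthonormalBasis ℂ (H i)).toBasis)

/-- The inner product for which the product basis is orthonormal. By `inner_tprod` it does not
depend on the chosen bases. -/
@[reducible]
def core [Finite ι] [∀ i, FiniteDimensional ℂ (H i)] :
    InnerProductSpace.Core ℂ (HTensor H) :=
  letI : Fintype ι := Fintype.ofFinite ι
  letI : DecidableEq ι := Classical.decEq ι
  { inner := fun x y => ∑ p, (starRingEnd ℂ) ((basis H).repr x p) * (basis H).repr y p
    conj_inner_symm := fun x y => by simp [mul_comm]
    re_inner_nonneg := fun x => by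
      simp only [← Complex.normSq_eq_conj_mul_self, map_sum]
      refine Finset.sum_nonneg fun p _ => ?_
      simpa using Complex.normSq_nonneg _
    add_left := fun x y z => by simp [add_mul, Finset.sum_add_distrib]
    smul_left := fun x y r => by simp [Finset.mul_sum, mul_assoc]
    definite := fun x hx => by
      refine (basis H).ext_elem fun p => ?_
      have hx' : ∑ p, Complex.normSq ((basis H).repr x p) = 0 := by
        have : ((∑ p, Complex.normSq ((basis H).repr x p) : ℝ) : ℂ) = 0 := by
          rw [← hx]; push_cast
          exact Finset.sum_congr rfl fun p _ => Complex.normSq_eq_conj_mul_self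
        exact_mod_cast this
      have := (Finset.sum_eq_zero_iff_of_nonneg fun p _ => Complex.normSq_nonneg _).1 hx' p
        (Finset.mem_univ p)
      simpa using this }

instance instNormedAddCommGroup [Finite ι] [∀ i, FiniteDimensional ℂ (H i)] :
    NormedAddCommGroup (HTensor H) :=
  @InnerProductSpace.Core.toNormedAddCommGroup ℂ (HTensor H) _ _ _ (core H)

instance instInnerProductSpace [Finite ι] [∀ i, FiniteDimensional ℂ (H i)] :
    InnerProductSpace ℂ (HTensor H) :=
  InnerProductSpace.ofCore (core H).toCore

variable {H}

theorem inner_tprod [Fintype ι] [∀ i, FiniteDimensional ℂ (H i)] (x y : ∀ i, H i) :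
    inner ℂ (tprod x) (tprod y) = ∏ i, inner ℂ (x i) (y i) := by
  classical
  have h : inner ℂ (tprod x) (tprod y) = ∑ p : ∀ i, Fin (Module.finrank ℂ (H i)),
      (starRingEnd ℂ) ((basis H).repr (tprod x) p) * (basis H).repr (tprod y) p := by
    change @Finset.sum _ _ _ _ _ = _
    refine Finset.sum_congr ?_ fun _ _ => rfl
    ext p; simp
  have hr : ∀ (z : ∀ i, H i) p, (basis H).repr (tprod z) p
      = ∏ i, inner ℂ (stdOrthonormalBasis ℂ (H i) (p i)) (z i) := by
    intro z p
    have := Basis.piTensorProduct_repr_tprod_apply (R := ℂ)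
      (fun i => (stdOrthonormalBasis ℂ (H i)).toBasis) z p
    refine this.trans (Finset.prod_congr rfl fun i _ => ?_)
    rw [OrthonormalBasis.coe_toBasis_repr_apply, OrthonormalBasis.repr_apply_apply]
  rw [h]
  simp only [hr, map_prod, ← Finset.prod_mul_distrib, inner_conj_symm]
  have : ∀ i, inner ℂ (x i) (y i) = ∑ j, inner ℂ (x i) (stdOrthonormalBasis ℂ (H i) j)
      * inner ℂ (stdOrthonormalBasis ℂ (H i) j) (y i) :=
    fun i => ((stdOrthonormalBasis ℂ (H i)).sum_inner_mul_inner _ _).symm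
  simp only [this]
  rw [Finset.prod_univ_sum]
  simp

@[elab_as_elim]
theorem induction {p : HTensor H → Prop} (smul_tprod : ∀ (c : ℂ) x, p (c • tprod x))
    (add : ∀ x y, p x → p y → p (x + y)) (z : HTensor H) : p z :=
  PiTensorProduct.induction_on (motive := p) z smul_tprod add

/-- The tensor product of a family of linear maps. -/
def map (f : ∀ i, H i →ₗ[ℂ] H i) : HTensor H →ₗ[ℂ] HTensor H :=
  PiTensorProduct.map f

@[simp]
theorem map_tprod (f : ∀ i, H i →ₗ[ℂ] H i) (x : ∀ i, H i) :
    map f (tprod x) = tprod fun i => f i (x i) :=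
  PiTensorProduct.map_tprod (R := ℂ) _ _

theorem ext {M : Type*} [AddCommGroup M] [Module ℂ M] {f g : HTensor H →ₗ[ℂ] M}
    (h : ∀ x, f (tprod x) = g (tprod x)) : f = g :=
  PiTensorProduct.ext (R := ℂ) (MultilinearMap.ext h)

end HTensor

/-! ### Partitioned Hilbert spaces, routes, practical isometries -/

/-- A finite-dimensional Hilbert space with an orthogonal partition indexed by the finite set `Z`
(sectors may be zero). -/
structure PartitionedSpace (Z : Type u) [Finite Z] where
  /-- the underlying Hilbert space -/
  H : Type v
  [normed : NormedAddCommGroup H]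
  [innerProd : InnerProductSpace ℂ H]
  [finiteDim : FiniteDimensional ℂ H]
  /-- the orthogonal projectors -/
  proj : Z → H →ₗ[ℂ] H
  proj_symm : ∀ k, (proj k).IsSymmetric
  proj_idem : ∀ k, proj k ∘ₗ proj k = proj k
  proj_orth : ∀ k l, k ≠ l → proj k ∘ₗ proj l = 0
  sum_proj : ∑ᶠ k, proj k = LinearMap.id

attribute [instance] PartitionedSpace.normed PartitionedSpace.innerProd PartitionedSpace.finiteDim

/-- The tensor product of a finite family of partitioned spaces; its sectors are indexed by the
product of the index sets. -/
def PartitionedSpace.tensor {ι : Type u} [Finite ι] {Z : ι → Type u} [∀ i, Finite (Z i)]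
    (A : ∀ i, PartitionedSpace.{u, v} (Z i)) : PartitionedSpace.{u, max u v} (∀ i, Z i) where
  H := HTensor fun i => (A i).H
  proj k := HTensor.map fun i => (A i).proj (k i)
  proj_symm k := by
    have := Fintype.ofFinite ι
    intro x y
    induction x using HTensor.induction with
    | add x x' hx hx' => simp only [map_add, inner_add_left, hx, hx']
    | smul_tprod c x =>
      induction y using HTensor.induction with
      | add y y' hy hy' => simp only [map_add, inner_add_right, hy, hy']
      | smul_tprod d y =>
        simp only [map_smul, HTensor.map_tprod, inner_smul_left, inner_smul_right,
          HTensor.inner_tprod]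
        rw [Finset.prod_congr rfl fun i _ => (A i).proj_symm (k i) (x i) (y i)]
  proj_idem k := HTensor.ext fun x => by
    simp only [LinearMap.comp_apply, HTensor.map_tprod]
    congr 1; funext i
    exact LinearMap.congr_fun ((A i).proj_idem (k i)) (x i)
  proj_orth k l hkl := HTensor.ext fun x => by
    obtain ⟨i, hi⟩ := Function.ne_iff.1 hkl
    simp only [LinearMap.comp_apply, HTensor.map_tprod, LinearMap.zero_apply]
    exact (PiTensorProduct.tprod ℂ).map_coord_zero i
      (LinearMap.congr_fun ((A i).proj_orth _ _ hi) (x i))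
  sum_proj := by
    classical
    have := Fintype.ofFinite ι
    have := fun i => Fintype.ofFinite (Z i)
    rw [finsum_eq_sum_of_fintype]
    refine HTensor.ext fun x => ?_
    simp only [LinearMap.sum_apply, HTensor.map_tprod, LinearMap.id_apply]
    have h : ∀ i, x i = ∑ z, (A i).proj z (x i) := fun i => by
      have := LinearMap.congr_fun ((A i).sum_proj) (x i)
      rw [finsum_eq_sum_of_fintype] at this
      simpa using this.symm
    conv_rhs => rw [show x = fun i => ∑ z, (A i).proj z (x i) from funext h]
    exact ((PiTensorProduct.tprod ℂ).map_sum fun i z => (A i).proj z (x i)).symm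

section Routes

variable {Z Z' : Type u} [Finite Z] [Finite Z']

/-- `f` follows the route `r`: `f = ∑ r^l_k μ^l ∘ f ∘ π^k`. -/
def FollowsRoute (A : PartitionedSpace.{u, v} Z) (B : PartitionedSpace.{u, w} Z')
    (r : Z → Z' → Prop) (f : A.H →ₗ[ℂ] B.H) : Prop :=
  f = ∑ᶠ (k) (l) (_ : r k l), B.proj l ∘ₗ f ∘ₗ A.proj k

/-- The practical input set of a relation; the practical output set is `inputSet (flip r)`. -/
def inputSet {Z Z' : Type u} (r : Z → Z' → Prop) : Set Z := {k | ∃ l, r k l}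

/-- The sum of the sectors of `A` with index in `S`. -/
def PartitionedSpace.sectors (A : PartitionedSpace.{u, v} Z) (S : Set Z) : Submodule ℂ A.H :=
  ⨆ k ∈ S, LinearMap.range (A.proj k)

/-- `(r, U)` is a routed map and a practical isometry: `U` follows `r` and is an isometry on the
practical input space of `r`. -/
def IsPracticalIsometry (A : PartitionedSpace.{u, v} Z) (B : PartitionedSpace.{u, w} Z')
    (r : Z → Z' → Prop) (U : A.H →ₗ[ℂ] B.H) : Prop :=
  FollowsRoute A B r U ∧ ∀ x ∈ A.sectors (inputSet r), ‖U x‖ = ‖x‖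

/-- `(r, U)` and its adjoint `(rᵀ, U†)` are practical isometries. -/
def IsPracticalUnitary (A : PartitionedSpace.{u, v} Z) (B : PartitionedSpace.{u, w} Z')
    (r : Z → Z' → Prop) (U : A.H →ₗ[ℂ] B.H) : Prop :=
  IsPracticalIsometry A B r U ∧ IsPracticalIsometry B A (flip r) (LinearMap.adjoint U)

/-- The sequential composition of `r` followed by `s` is proper for practical isometries:
`(r ∘ rᵀ)[S_s] ⊆ S_s`. -/
def ProperForIsometries {Z Z' Z'' : Type u} (r : Z → Z' → Prop) (s : Z' → Z'' → Prop) : Prop :=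
  ∀ l ∈ inputSet s, ∀ l', (∃ k, r k l ∧ r k l') → l' ∈ inputSet s

/-- Proper for practical unitaries: moreover `(sᵀ ∘ s)[T_r] ⊆ T_r`. -/
def ProperForUnitaries {Z Z' Z'' : Type u} (r : Z → Z' → Prop) (s : Z' → Z'' → Prop) : Prop :=
  ProperForIsometries r s ∧ ProperForIsometries (flip s) (flip r)

end Routes

/-! ### Corelations -/

/-- A corelation from `A` to `B`: an equivalence relation on the disjoint union. -/
abbrev Corel (A B : Type u) : Type u := Setoid (A ⊕ B)

/-- The relations of two corelations `κ : A → B`, `ι : B → C`, put together on `A ⊔ B ⊔ C`. -/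
inductive Corel.Glue {A B C : Type u} (κ : Corel A B) (ι : Corel B C) :
    A ⊕ B ⊕ C → A ⊕ B ⊕ C → Prop
  | left (x y : A ⊕ B) (h : κ x y) :
      Corel.Glue κ ι (Sum.map id Sum.inl x) (Sum.map id Sum.inl y)
  | right (x y : B ⊕ C) (h : ι x y) : Corel.Glue κ ι (Sum.inr x) (Sum.inr y)

/-- The composition of corelations, `κ` first: restrict to `A ⊔ C` the equivalence relation
generated on `A ⊔ B ⊔ C` by `κ` and `ι`. -/
@[reducible]
def Corel.comp {A B C : Type u} (κ : Corel A B) (ι : Corel B C) : Corel A C :=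
  (Relation.EqvGen.setoid (Corel.Glue κ ι)).comap (Sum.map id Sum.inr)

/-- The relation associated to a corelation, on families of index values. -/
def Corel.bar {A B : Type u} (κ : Corel A B) (k : A → ℕ) (l : B → ℕ) : Prop :=
  ∀ x y, κ x y → Sum.elim k l x = Sum.elim k l y

/-! ### Indexed wire systems and IODAGs -/

/-- An indexed wire system. -/
structure WireSystem where
  Wire : Type u
  Idx : Type u
  [finiteWire : Finite Wire]
  [finiteIdx : Finite Idx]
  place : Idx → Wire
  rel : Setoid Idx

attribute [instance] WireSystem.finiteWire WireSystem.finiteIdx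

/-- An indexed open directed acyclic graph from `I` to `O`. -/
structure IODAG (I O : WireSystem.{u}) where
  /-- inner edges -/
  Edge : Type u
  Node : Type u
  /-- indices of the inner edges -/
  EdgeIdx : Type u
  [finiteEdge : Finite Edge]
  [finiteNode : Finite Node]
  [finiteEdgeIdx : Finite EdgeIdx]
  /-- the node that a wire enters -/
  head : I.Wire ⊕ Edge → Node
  /-- the node that a wire leaves -/
  tail : Edge ⊕ O.Wire → Node
  edgePlace : EdgeIdx → Edge
  rel : Setoid (I.Idx ⊕ EdgeIdx ⊕ O.Idx)
  rel_input : ∀ k k' : I.Idx, rel (.inl k) (.inl k') ↔ I.rel k k'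
  rel_output : ∀ k k' : O.Idx, rel (.inr (.inr k)) (.inr (.inr k')) ↔ O.rel k k'
  acyclic : ∀ n, ¬ Relation.TransGen (fun a b => ∃ e, tail (.inl e) = a ∧ head (.inr e) = b) n n

attribute [instance] IODAG.finiteEdge IODAG.finiteNode IODAG.finiteEdgeIdx

namespace IODAG

variable {I O : WireSystem.{u}} (Γ : IODAG I O)

/-- All wires: inputs, inner edges, outputs. -/
abbrev Wire : Type u := I.Wire ⊕ Γ.Edge ⊕ O.Wire

/-- All indices. -/
abbrev Idx : Type u := I.Idx ⊕ Γ.EdgeIdx ⊕ O.Idx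

/-- The placement of all indices. -/
def place : Γ.Idx → Γ.Wire := Sum.map I.place (Sum.map Γ.edgePlace O.place)

/-- The global input wires. -/
def inputs : Set Γ.Wire := Set.range Sum.inl

/-- The global output wires. -/
def outputs : Set Γ.Wire := Set.range (Sum.inr ∘ Sum.inr)

/-- The wires that enter a node. -/
def into (n : Γ.Node) : Set Γ.Wire := Sum.map id Sum.inl '' (Γ.head ⁻¹' {n})

/-- The wires that leave a node. -/
def outof (n : Γ.Node) : Set Γ.Wire := Sum.inr '' (Γ.tail ⁻¹' {n})

/-- `n` is a starting point of the equivalence class `c`. -/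
def IsStartingPoint (c : Quotient Γ.rel) (n : Γ.Node) : Prop :=
  (∃ k : Γ.Idx, Quotient.mk Γ.rel k = c ∧ Γ.place k ∈ Γ.outof n) ∧
    ∀ k : Γ.Idx, Quotient.mk Γ.rel k = c → Γ.place k ∉ Γ.into n

/-- `n` is an endpoint of the equivalence class `c`. -/
def IsEndpoint (c : Quotient Γ.rel) (n : Γ.Node) : Prop :=
  (∃ k : Γ.Idx, Quotient.mk Γ.rel k = c ∧ Γ.place k ∈ Γ.into n) ∧
    ∀ k : Γ.Idx, Quotient.mk Γ.rel k = c → Γ.place k ∉ Γ.outof n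

/-- Iso-IODAGs. -/
def IsIso : Prop :=
  ∀ c : Quotient Γ.rel,
    (∀ n m, Γ.IsStartingPoint c n → Γ.IsStartingPoint c m → n = m) ∧
      ((∃ k : I.Idx, Quotient.mk Γ.rel (.inl k) = c) → ∀ n, ¬ Γ.IsStartingPoint c n)

/-- Uni-IODAGs. -/
def IsUni : Prop :=
  Γ.IsIso ∧ ∀ c : Quotient Γ.rel,
    (∀ n m, Γ.IsEndpoint c n → Γ.IsEndpoint c m → n = m) ∧
      ((∃ k : O.Idx, Quotient.mk Γ.rel (.inr (.inr k)) = c) → ∀ n, ¬ Γ.IsEndpoint c n)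

/-- The indices placed on the wire `e`. -/
abbrev IdxAt (e : Γ.Wire) : Type u := {k : Γ.Idx // Γ.place k = e}

/-- The disjoint union of the sets of indices of the wires in `S`. -/
abbrev IdxOn (S : Set Γ.Wire) : Type u := Σ e : S, Γ.IdxAt e

/-- An element of `IdxOn S ⊔ IdxOn T`, seen as an index of the graph. -/
def under {S T : Set Γ.Wire} : Γ.IdxOn S ⊕ Γ.IdxOn T → Γ.Idx :=
  Sum.elim (fun x => x.2.1) (fun x => x.2.1)

/-- The corelation between the indices of two sets of wires that relates two elements if and only
if they are related in the graph. -/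
@[reducible]
def restrict (S T : Set Γ.Wire) : Corel (Γ.IdxOn S) (Γ.IdxOn T) := Γ.rel.comap Γ.under

/-- The corelation of a node. -/
@[reducible]
def nodeCorel (n : Γ.Node) : Corel (Γ.IdxOn (Γ.into n)) (Γ.IdxOn (Γ.outof n)) :=
  Γ.restrict (Γ.into n) (Γ.outof n)

/-- The pre-processing corelation; on input indices the relation of the graph is that of `I`. -/
@[reducible]
def preCorel : Corel (Γ.IdxOn Γ.inputs) (Γ.IdxOn Γ.inputs) := Γ.restrict Γ.inputs Γ.inputs

/-- The total corelation. -/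
@[reducible]
def totCorel : Corel (Γ.IdxOn Γ.inputs) (Γ.IdxOn Γ.outputs) := Γ.restrict Γ.inputs Γ.outputs

/-- `S` is the disjoint union of `A` and `R`. -/
def IsDisjUnion {α : Type u} (A R S : Set α) : Prop := Disjoint A R ∧ A ∪ R = S

/-- Suppose that `S = into n ⊔ R` and `T = outof n ⊔ R`. This is the parallel composition of the
corelation of the node `n` with the identity corelation on the indices of the wires in `R`. -/
@[reducible]
def stepCorel (R S T : Set Γ.Wire) : Corel (Γ.IdxOn S) (Γ.IdxOn T) where
  r x y := (Γ.place (Γ.under x) ∉ R ∧ Γ.place (Γ.under y) ∉ R ∧ Γ.rel (Γ.under x) (Γ.under y)) ∨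
    (Γ.place (Γ.under x) ∈ R ∧ Γ.under x = Γ.under y)
  iseqv :=
    { refl := fun x => by
        by_cases h : Γ.place (Γ.under x) ∈ R
        · exact .inr ⟨h, rfl⟩
        · exact .inl ⟨h, h, Γ.rel.refl' _⟩
      symm := by
        rintro x y (⟨h1, h2, h3⟩ | ⟨h1, h2⟩)
        · exact .inl ⟨h2, h1, Γ.rel.symm' h3⟩
        · exact .inr ⟨h2 ▸ h1, h2.symm⟩
      trans := by
        rintro x y z (⟨h1, h2, h3⟩ | ⟨h1, h2⟩) (⟨g1, g2, g3⟩ | ⟨g1, g2⟩)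
        · exact .inl ⟨h1, g2, Γ.rel.trans' h3 g3⟩
        · exact absurd g1 h2
        · exact absurd (h2 ▸ h1) g1
        · exact .inr ⟨h1, h2.trans g2⟩ }

/-! ### Interpretations and their meaning -/

/-- The data of an interpretation: lengths of the indices, a partitioned space for each wire, a
linear map for each node. -/
structure Interpretation where
  length : Γ.Idx → ℕ
  length_pos : ∀ k, 0 < length k
  length_rel : ∀ k k', Γ.rel k k' → length k = length k'
  sys : ∀ e : Γ.Wire, PartitionedSpace.{u, v} (∀ k : Γ.IdxAt e, Fin (length k))
  morph : ∀ n : Γ.Node,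
    (PartitionedSpace.tensor fun e : Γ.into n => sys e).H →ₗ[ℂ]
      (PartitionedSpace.tensor fun e : Γ.outof n => sys e).H

namespace Interpretation

variable {Γ} (J : Interpretation.{u, v} Γ)

/-- The values of the indices of the wires in `S`. -/
abbrev MultiIdx (S : Set Γ.Wire) : Type u := ∀ e : S, ∀ k : Γ.IdxAt e, Fin (J.length k)

/-- The tensor product of the partitioned spaces of the wires in `S`. -/
def space (S : Set Γ.Wire) : PartitionedSpace.{u, max u v} (J.MultiIdx S) :=
  PartitionedSpace.tensor fun e : S => J.sys e

/-- The relation associated to a corelation. -/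
def route {S T : Set Γ.Wire} (κ : Corel (Γ.IdxOn S) (Γ.IdxOn T)) :
    J.MultiIdx S → J.MultiIdx T → Prop :=
  fun k l => κ.bar (fun x => k x.1 x.2) (fun x => l x.1 x.2)

/-- Each node is interpreted by a practically isometric routed map with route `κ_n`. -/
def IsPracticallyIsometric : Prop :=
  ∀ n, IsPracticalIsometry (J.space (Γ.into n)) (J.space (Γ.outof n)) (J.route (Γ.nodeCorel n))
    (J.morph n)

/-- Each node is interpreted by a practically unitary routed map with route `κ_n`. -/
def IsPracticallyUnitary : Prop :=
  ∀ n, IsPracticalUnitary (J.space (Γ.into n)) (J.space (Γ.outof n)) (J.route (Γ.nodeCorel n))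
    (J.morph n)

/-- The pre-processing projector. -/
def preMap : (J.space Γ.inputs).H →ₗ[ℂ] (J.space Γ.inputs).H :=
  ∑ᶠ (k) (_ : J.route Γ.preCorel k k), (J.space Γ.inputs).proj k

/-- If `S = A ⊔ R`, the bijection between `S` and the disjoint union of the types `A` and `R`. -/
def splitEquiv {α : Type u} {A R S : Set α} (h : IsDisjUnion A R S) : S ≃ A ⊕ R :=
  (Equiv.ofBijective
    (Sum.elim (fun a => ⟨a.1, h.2 ▸ Or.inl a.2⟩) (fun r => ⟨r.1, h.2 ▸ Or.inr r.2⟩) :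
      A ⊕ R → S)
    ⟨by
      rintro (⟨a, ha⟩ | ⟨a, ha⟩) (⟨b, hb⟩ | ⟨b, hb⟩) hab <;>
        simp only [Sum.elim_inl, Sum.elim_inr, Subtype.mk.injEq] at hab <;> subst hab
      · rfl
      · exact (Set.disjoint_left.1 h.1 ha hb).elim
      · exact (Set.disjoint_left.1 h.1 hb ha).elim
      · rfl,
    by
      rintro ⟨s, hs⟩
      rcases (h.2.symm ▸ hs : s ∈ A ∪ R) with ha | hr
      · exact ⟨.inl ⟨s, ha⟩, rfl⟩
      · exact ⟨.inr ⟨s, hr⟩, rfl⟩⟩).symm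

/-- If `S = A ⊔ R`, the canonical isomorphism `⨂_S ≃ (⨂_A) ⊗ (⨂_R)`. -/
def split {A R S : Set Γ.Wire} (h : IsDisjUnion A R S) :
    (J.space S).H ≃ₗ[ℂ] (J.space A).H ⊗[ℂ] (J.space R).H :=
  (PiTensorProduct.reindex ℂ (fun e : S => (J.sys e).H) (splitEquiv h)).trans
    (PiTensorProduct.tmulEquivDep ℂ
      (fun j : A ⊕ R => (J.sys ((splitEquiv h).symm j)).H)).symm

theorem split_tprod {A R S : Set Γ.Wire} (h : IsDisjUnion A R S) (x : ∀ e : S, (J.sys e).H) :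
    J.split h (HTensor.tprod x) =
      (HTensor.tprod fun e : A => x ⟨e.1, h.2 ▸ Or.inl e.2⟩ : (J.space A).H) ⊗ₜ[ℂ]
        (HTensor.tprod fun e : R => x ⟨e.1, h.2 ▸ Or.inr e.2⟩ : (J.space R).H) := by
  have h1 := PiTensorProduct.reindex_tprod (R := ℂ) (s := fun e : S => (J.sys e).H)
    (splitEquiv h) x
  have h2 := PiTensorProduct.tmulEquivDep_symm_apply (R := ℂ)
    (N := fun j : A ⊕ R => (J.sys ((splitEquiv h).symm j)).H) fun j => x ((splitEquiv h).symm j)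
  exact (congrArg _ h1).trans h2

/-- The map of the node `n` in parallel with the identity on the wires in `R`. -/
def stepMap {n : Γ.Node} {R S T : Set Γ.Wire} (hS : IsDisjUnion (Γ.into n) R S)
    (hT : IsDisjUnion (Γ.outof n) R T) : (J.space S).H →ₗ[ℂ] (J.space T).H :=
  (J.split hT).symm.toLinearMap ∘ₗ
    LinearMap.rTensor (J.space R).H (J.morph n) ∘ₗ (J.split hS).toLinearMap

/-- `J.Composite D S κ F`: the index-matching routed map `(κ, F)`, from the input wires to the set
`S` of wires, is obtained from the pre-processing by composing successively with the maps of the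
nodes in `D`, each used exactly once, in an order that agrees with the graph; a node can be used
as soon as all the wires that enter it are available. -/
inductive Composite : Set Γ.Node → (S : Set Γ.Wire) → Corel (Γ.IdxOn Γ.inputs) (Γ.IdxOn S) →
    ((J.space Γ.inputs).H →ₗ[ℂ] (J.space S).H) → Prop
  | pre : Composite ∅ Γ.inputs Γ.preCorel J.preMap
  | step {D : Set Γ.Node} {S : Set Γ.Wire} {κ : Corel (Γ.IdxOn Γ.inputs) (Γ.IdxOn S)}
      {F : (J.space Γ.inputs).H →ₗ[ℂ] (J.space S).H} {n : Γ.Node} {R T : Set Γ.Wire}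
      (h : Composite D S κ F) (hn : n ∉ D) (hS : IsDisjUnion (Γ.into n) R S)
      (hT : IsDisjUnion (Γ.outof n) R T) :
      Composite (insert n D) T (κ.comp (Γ.stepCorel R S T)) (J.stepMap hS hT ∘ₗ F)

/-- `(κ, M)` is the meaning of the interpretation: the pre-processing, followed by all the nodes
composed according to the graph. -/
def IsMeaning (κ : Corel (Γ.IdxOn Γ.inputs) (Γ.IdxOn Γ.outputs))
    (M : (J.space Γ.inputs).H →ₗ[ℂ] (J.space Γ.outputs).H) : Prop :=
  J.Composite Set.univ Γ.outputs κ M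

end Interpretation

end IODAG

end

/-!
The proof is an induction along the order in which the nodes are composed. Let `S` be the set of
wires available at some stage. Two facts are kept through the induction.

* *The corelation composed so far is the one induced by the graph on the global inputs and `S`*
  (`Composite.corel_eq`). In a composite, two related indices could fail to be connected only if
  their class entered the diagram in two places. Tracing an index on an available wire backwards
  ends at a global input or at a starting point that was already used
  (`Composite.exists_input_or_isStartingPoint`), so the iso-IODAG condition says precisely that the
  class enters at one place only. At the end, `S` consists of the global outputs and the corelation
  is the total one.
* *The map composed so far is a practical isometry.* The practical inputs of the route induced by
  the graph are the consistent families of values, those that take equal values on related indices,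
  because a consistent family extends to all wires (`Consistent.exists_extension`). A family on `S`
  that is reached by the route so far is consistent, hence is an input of the next step. This gives
  both properness and, with `IsPracticalIsometry.comp`, the induction step; that a node in parallel
  with identities is a practical isometry is `isPracticalIsometry_parMap`.

For adjoints, one needs in addition that two inputs of a step with a common output are both
consistent if one of them is (`Consistent.of_route_stepCorel`). This can fail only for a class that
ends at the node and also sits on a wire that bypasses it. Tracing the latter index forwards ends at
a global output or at a node that is not yet used (`exists_output_or_isEndpoint`), so that the
class would leave the diagram in two places, contrary to the uni-IODAG condition.

An order compatible with the graph exists by acyclicity: if the set of used nodes is not everything,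
a minimal unused node can be used next (`exists_isMeaning`).
-/

noncomputable section

/-! ### Routes, blockwise -/

section Routes

variable {Z Z' Z'' : Type u} [Finite Z] [Finite Z'] [Finite Z'']

theorem PartitionedSpace.sum_proj_apply [Fintype Z] (A : PartitionedSpace.{u, v} Z) (x : A.H) :
    ∑ k, A.proj k x = x := by
  have h := LinearMap.congr_fun A.sum_proj x
  rw [finsum_eq_sum_of_fintype] at h
  simpa using h

theorem PartitionedSpace.proj_proj (A : PartitionedSpace.{u, v} Z) (k : Z) (x : A.H) :
    A.proj k (A.proj k x) = A.proj k x :=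
  LinearMap.congr_fun (A.proj_idem k) x

theorem PartitionedSpace.proj_proj_of_ne (A : PartitionedSpace.{u, v} Z) {k l : Z} (h : k ≠ l)
    (x : A.H) : A.proj k (A.proj l x) = 0 :=
  LinearMap.congr_fun (A.proj_orth k l h) x

theorem PartitionedSpace.proj_mem_sectors (A : PartitionedSpace.{u, v} Z) {S : Set Z} {k : Z}
    (hk : k ∈ S) (x : A.H) : A.proj k x ∈ A.sectors S :=
  Submodule.mem_iSup_of_mem k (Submodule.mem_iSup_of_mem hk ⟨x, rfl⟩)

theorem PartitionedSpace.sectors_mono (A : PartitionedSpace.{u, v} Z) {S T : Set Z} (h : S ⊆ T) :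
    A.sectors S ≤ A.sectors T :=
  biSup_mono h

/-- A map follows a route if and only if its blocks outside the route vanish. -/
theorem followsRoute_iff {A : PartitionedSpace.{u, v} Z} {B : PartitionedSpace.{u, w} Z'}
    {r : Z → Z' → Prop} {f : A.H →ₗ[ℂ] B.H} :
    FollowsRoute A B r f ↔ ∀ k l, ¬ r k l → ∀ x, B.proj l (f (A.proj k x)) = 0 := by
  classical
  have := Fintype.ofFinite Z
  have := Fintype.ofFinite Z'
  have key : (∑ᶠ (k) (l) (_ : r k l), B.proj l ∘ₗ f ∘ₗ A.proj k) =
      ∑ k, ∑ l, if r k l then B.proj l ∘ₗ f ∘ₗ A.proj k else 0 := by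
    simp only [finsum_eq_sum_of_fintype, finsum_eq_if]
  unfold FollowsRoute
  rw [key]
  constructor
  · intro h k₀ l₀ hkl x
    rw [h]
    simp only [LinearMap.sum_apply, map_sum]
    refine Finset.sum_eq_zero fun k _ => Finset.sum_eq_zero fun l _ => ?_
    split_ifs with hr
    · simp only [LinearMap.comp_apply]
      by_cases hk : k = k₀
      · by_cases hl : l = l₀
        · exact absurd (hk ▸ hl ▸ hr) hkl
        · exact B.proj_proj_of_ne (Ne.symm hl) _
      · simp [A.proj_proj_of_ne hk]
    · simp
  · intro h
    ext x
    simp only [LinearMap.sum_apply]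
    conv_lhs => rw [← A.sum_proj_apply x, map_sum]
    refine Finset.sum_congr rfl fun k _ => ?_
    conv_lhs => rw [← B.sum_proj_apply (f (A.proj k x))]
    refine Finset.sum_congr rfl fun l _ => ?_
    split_ifs with hr
    · rfl
    · simpa using h k l hr x

/-- A map that follows a route sends the sectors in `S` into the sectors related to them. -/
theorem FollowsRoute.apply_mem_sectors {A : PartitionedSpace.{u, v} Z}
    {B : PartitionedSpace.{u, w} Z'} {r : Z → Z' → Prop} {f : A.H →ₗ[ℂ] B.H}
    (hf : FollowsRoute A B r f) {S : Set Z} {T : Set Z'} (h : ∀ k ∈ S, ∀ l, r k l → l ∈ T)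
    {x : A.H} (hx : x ∈ A.sectors S) : f x ∈ B.sectors T := by
  have := Fintype.ofFinite Z'
  suffices A.sectors S ≤ (B.sectors T).comap f from this hx
  refine iSup₂_le fun k hk => ?_
  rintro _ ⟨y, rfl⟩
  rw [Submodule.mem_comap, ← B.sum_proj_apply (f _)]
  refine Submodule.sum_mem _ fun l _ => ?_
  by_cases hr : r k l
  · exact B.proj_mem_sectors (h k hk l hr) _
  · rw [followsRoute_iff.1 hf k l hr]
    exact Submodule.zero_mem _

/-- Practical isometries compose along a route `t` that contains the composite of the two routes,
provided that the inputs of `t` are inputs of `r` and are sent by `r` into the inputs of `s`. -/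
theorem IsPracticalIsometry.comp {A : PartitionedSpace.{u, v} Z}
    {B : PartitionedSpace.{u, v} Z'} {C : PartitionedSpace.{u, v} Z''} {r : Z → Z' → Prop}
    {s : Z' → Z'' → Prop} {t : Z → Z'' → Prop} {f : A.H →ₗ[ℂ] B.H} {g : B.H →ₗ[ℂ] C.H}
    (hf : IsPracticalIsometry A B r f) (hg : IsPracticalIsometry B C s g)
    (ht : ∀ k l m, r k l → s l m → t k m) (htr : inputSet t ⊆ inputSet r)
    (hts : ∀ k ∈ inputSet t, ∀ l, r k l → l ∈ inputSet s) :
    IsPracticalIsometry A C t (g ∘ₗ f) := by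
  have := Fintype.ofFinite Z'
  refine ⟨followsRoute_iff.2 fun k m hkm x => ?_, fun x hx => ?_⟩
  · rw [LinearMap.comp_apply, ← B.sum_proj_apply (f _), map_sum, map_sum]
    refine Finset.sum_eq_zero fun l _ => ?_
    by_cases hr : r k l
    · exact followsRoute_iff.1 hg.1 l m (fun hs => hkm (ht k l m hr hs)) _
    · simp [followsRoute_iff.1 hf.1 k l hr]
  · rw [LinearMap.comp_apply, hg.2 _ (hf.1.apply_mem_sectors hts hx),
      hf.2 x (A.sectors_mono htr hx)]

theorem IsPracticalIsometry.inner_map_map {A : PartitionedSpace.{u, v} Z}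
    {B : PartitionedSpace.{u, w} Z'} {r : Z → Z' → Prop} {f : A.H →ₗ[ℂ] B.H}
    (hf : IsPracticalIsometry A B r f) {x y : A.H} (hx : x ∈ A.sectors (inputSet r))
    (hy : y ∈ A.sectors (inputSet r)) : inner ℂ (f x) (f y) = inner ℂ x y :=
  LinearIsometry.inner_map_map
    (⟨f.domRestrict (A.sectors (inputSet r)), fun z => hf.2 z z.2⟩ :
      A.sectors (inputSet r) →ₗᵢ[ℂ] B.H) ⟨x, hx⟩ ⟨y, hy⟩

/-- The sum of the projectors onto the sectors in `S` is a practical isometry along every relation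
that relates `k` and `l` if and only if `k = l ∈ S`. -/
theorem isPracticalIsometry_sum_proj (A : PartitionedSpace.{u, v} Z) {S : Set Z}
    {r : Z → Z → Prop} (hr : ∀ k l, r k l ↔ k = l ∧ k ∈ S) :
    IsPracticalIsometry A A r (∑ᶠ (k) (_ : k ∈ S), A.proj k) := by
  classical
  have := Fintype.ofFinite Z
  have key : (∑ᶠ (k) (_ : k ∈ S), A.proj k) = ∑ k, if k ∈ S then A.proj k else 0 := by
    simp only [finsum_eq_sum_of_fintype, finsum_eq_if]
  have hp : ∀ k x, (∑ᶠ (k) (_ : k ∈ S), A.proj k) (A.proj k x) =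
      if k ∈ S then A.proj k x else 0 := by
    intro k x
    rw [key, LinearMap.sum_apply, Finset.sum_eq_single k]
    · split_ifs
      · exact A.proj_proj k x
      · rfl
    · intro l _ hl
      split_ifs
      · exact A.proj_proj_of_ne hl x
      · rfl
    · simp
  refine ⟨followsRoute_iff.2 fun k l hkl x => ?_, fun x hx => ?_⟩
  · rw [hp]
    split_ifs with hk
    · exact A.proj_proj_of_ne (fun h => hkl ((hr k l).2 ⟨h.symm, hk⟩)) x
    · exact map_zero _
  · suffices A.sectors (inputSet r) ≤
        LinearMap.eqLocus (∑ᶠ (k) (_ : k ∈ S), A.proj k) LinearMap.id by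
      rw [show _ = x from this hx]
    refine iSup₂_le fun k hk => ?_
    rintro _ ⟨y, rfl⟩
    obtain ⟨l, hl⟩ := hk
    change _ = _
    rw [hp, if_pos ((hr k l).1 hl).2]
    rfl

theorem adjoint_sum_proj (A : PartitionedSpace.{u, v} Z) (S : Set Z) :
    LinearMap.adjoint (∑ᶠ (k) (_ : k ∈ S), A.proj k) = ∑ᶠ (k) (_ : k ∈ S), A.proj k := by
  classical
  have := Fintype.ofFinite Z
  have key : (∑ᶠ (k) (_ : k ∈ S), A.proj k) = ∑ k, if k ∈ S then A.proj k else 0 := by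
    simp only [finsum_eq_sum_of_fintype, finsum_eq_if]
  rw [key, map_sum]
  refine Finset.sum_congr rfl fun k _ => ?_
  split_ifs
  · exact ((LinearMap.isSymmetric_iff_isSelfAdjoint _).1 (A.proj_symm k))
  · exact map_zero _

/-- The sectors of a tensor product are spanned by the pure tensors of vectors that each lie in a
sector. -/
theorem PartitionedSpace.sectors_tensor_le {ι : Type u} [Finite ι] {Z : ι → Type u}
    [∀ i, Finite (Z i)] (A : ∀ i, PartitionedSpace.{u, v} (Z i)) (S : Set (∀ i, Z i)) :
    (PartitionedSpace.tensor A).sectors S ≤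
      Submodule.span ℂ {z | ∃ k ∈ S, ∃ x : ∀ i, (A i).H, (∀ i, (A i).proj (k i) (x i) = x i) ∧
        z = HTensor.tprod x} := by
  refine iSup₂_le fun k hk => ?_
  rintro _ ⟨z, rfl⟩
  change HTensor.map (fun i => (A i).proj (k i)) z ∈ _
  induction z using HTensor.induction with
  | add x y hx hy => rw [map_add]; exact Submodule.add_mem _ hx hy
  | smul_tprod c x =>
    rw [map_smul, HTensor.map_tprod]
    exact Submodule.smul_mem _ _ (Submodule.subset_span
      ⟨k, hk, _, fun i => (A i).proj_proj _ _, rfl⟩)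

end Routes

/-! ### Maps in parallel with an identity -/

namespace IODAG.Interpretation

variable {I O : WireSystem.{u}} {Γ : IODAG I O} (J : Interpretation.{u, v} Γ)

/-- The restriction of a family of values to the wires in `A ⊆ S`. -/
def res {A R S : Set Γ.Wire} (h : IsDisjUnion A R S) (k : J.MultiIdx S) : J.MultiIdx A :=
  fun e => k ⟨e.1, h.2.subset (Or.inl e.2)⟩

/-- The restriction of a family of values to the wires in the second part `R` of `S = A ⊔ R`. -/
def resRight {A R S : Set Γ.Wire} (h : IsDisjUnion A R S) (k : J.MultiIdx S) : J.MultiIdx R :=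
  fun e => k ⟨e.1, h.2.subset (Or.inr e.2)⟩

/-- Pure tensors, as vectors of the space of a set of wires. -/
def pure {S : Set Γ.Wire} (x : ∀ e : S, (J.sys e).H) : (J.space S).H := HTensor.tprod x

@[elab_as_elim]
theorem induction_pure {S : Set Γ.Wire} {p : (J.space S).H → Prop}
    (smul_pure : ∀ (c : ℂ) x, p (c • J.pure x)) (add : ∀ x y, p x → p y → p (x + y))
    (z : (J.space S).H) : p z :=
  HTensor.induction smul_pure add z

theorem inner_pure {S : Set Γ.Wire} [Fintype S] (x y : ∀ e : S, (J.sys e).H) :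
    inner ℂ (J.pure x) (J.pure y) = ∏ e, inner ℂ (x e) (y e) :=
  HTensor.inner_tprod x y

theorem proj_pure {S : Set Γ.Wire} (k : J.MultiIdx S) (x : ∀ e : S, (J.sys e).H) :
    (J.space S).proj k (J.pure x) = J.pure fun e => (J.sys e).proj (k e) (x e) :=
  HTensor.map_tprod _ _

theorem split_pure {A R S : Set Γ.Wire} (h : IsDisjUnion A R S) (x : ∀ e : S, (J.sys e).H) :
    J.split h (J.pure x) =
      J.pure (fun e : A => x ⟨e.1, h.2.subset (Or.inl e.2)⟩) ⊗ₜ[ℂ]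
        J.pure fun e : R => x ⟨e.1, h.2.subset (Or.inr e.2)⟩ :=
  J.split_tprod h x

theorem exists_pure_eq_split_symm {A R S : Set Γ.Wire} (h : IsDisjUnion A R S)
    (a : ∀ e : A, (J.sys e).H) (b : ∀ e : R, (J.sys e).H) :
    ∃ x : ∀ e : S, (J.sys e).H, (J.split h).symm (J.pure a ⊗ₜ[ℂ] J.pure b) = J.pure x ∧
      (∀ e : A, x ⟨e.1, h.2.subset (Or.inl e.2)⟩ = a e) ∧
        ∀ e : R, x ⟨e.1, h.2.subset (Or.inr e.2)⟩ = b e := by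
  classical
  let x : ∀ e : S, (J.sys e).H := fun e =>
    if he : e.1 ∈ A then a ⟨e.1, he⟩
    else b ⟨e.1, (h.2.symm.subset e.2).resolve_left he⟩
  have ha : ∀ e : A, x ⟨e.1, h.2.subset (Or.inl e.2)⟩ = a e := fun e => dif_pos e.2
  have hb : ∀ e : R, x ⟨e.1, h.2.subset (Or.inr e.2)⟩ = b e := fun e =>
    dif_neg fun he => Set.disjoint_left.1 h.1 he e.2
  refine ⟨x, ?_, ha, hb⟩
  rw [LinearEquiv.symm_apply_eq, split_pure]
  simp only [ha, hb]

/-- The isomorphism between the two factors and the whole is unitary. -/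
theorem inner_split_symm_tmul {A R S : Set Γ.Wire} (h : IsDisjUnion A R S)
    (a a' : (J.space A).H) (b b' : (J.space R).H) :
    inner ℂ ((J.split h).symm (a ⊗ₜ b)) ((J.split h).symm (a' ⊗ₜ b')) =
      inner ℂ a a' * inner ℂ b b' := by
  have := Fintype.ofFinite A
  have := Fintype.ofFinite R
  have := Fintype.ofFinite S
  induction a using J.induction_pure with
  | add x y hx hy => simp only [TensorProduct.add_tmul, map_add, inner_add_left, hx, hy, add_mul]
  | smul_pure c a =>
  induction a' using J.induction_pure with
  | add x y hx hy => simp only [TensorProduct.add_tmul, map_add, inner_add_right, hx, hy, add_mul]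
  | smul_pure c' a' =>
  induction b using J.induction_pure with
  | add x y hx hy => simp only [TensorProduct.tmul_add, map_add, inner_add_left, hx, hy, mul_add]
  | smul_pure d b =>
  induction b' using J.induction_pure with
  | add x y hx hy => simp only [TensorProduct.tmul_add, map_add, inner_add_right, hx, hy, mul_add]
  | smul_pure d' b' =>
  obtain ⟨x, hx, hxa, hxb⟩ := J.exists_pure_eq_split_symm h a b
  obtain ⟨x', hx', hxa', hxb'⟩ := J.exists_pure_eq_split_symm h a' b'
  have key : inner ℂ (J.pure x) (J.pure x') =
      inner ℂ (J.pure a) (J.pure a') * inner ℂ (J.pure b) (J.pure b') := by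
    rw [inner_pure, inner_pure, inner_pure, ← (splitEquiv h).symm.prod_comp,
      Fintype.prod_sum_type]
    refine congrArg₂ (· * ·) (Finset.prod_congr rfl fun e _ => ?_)
      (Finset.prod_congr rfl fun e _ => ?_)
    · rw [← hxa, ← hxa']; rfl
    · rw [← hxb, ← hxb']; rfl
  simp only [← TensorProduct.smul_tmul', TensorProduct.tmul_smul, map_smul, inner_smul_left,
    inner_smul_right, hx, hx', key]
  ring

theorem proj_split_symm_tmul {A R S : Set Γ.Wire} (h : IsDisjUnion A R S) (k : J.MultiIdx S)
    (a : (J.space A).H) (b : (J.space R).H) :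
    (J.space S).proj k ((J.split h).symm (a ⊗ₜ b)) =
      (J.split h).symm
        ((J.space A).proj (J.res h k) a ⊗ₜ (J.space R).proj (J.resRight h k) b) := by
  induction a using J.induction_pure with
  | add x y hx hy => simp only [TensorProduct.add_tmul, map_add, hx, hy]
  | smul_pure c a =>
  induction b using J.induction_pure with
  | add x y hx hy => simp only [TensorProduct.tmul_add, map_add, hx, hy]
  | smul_pure d b =>
  obtain ⟨x, hx, hxa, hxb⟩ := J.exists_pure_eq_split_symm h a b
  have key : (J.space S).proj k (J.pure x) = (J.split h).symm
      ((J.space A).proj (J.res h k) (J.pure a) ⊗ₜ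
        (J.space R).proj (J.resRight h k) (J.pure b)) := by
    rw [LinearEquiv.eq_symm_apply]
    simp only [proj_pure, split_pure, hxa, hxb]
    rfl
  simp only [← TensorProduct.smul_tmul', TensorProduct.tmul_smul, map_smul, hx, key]

/-- The sectors of the space of a set of wires are spanned by the pure tensors of vectors that each
lie in a sector. -/
theorem sectors_space_le {S : Set Γ.Wire} (K : Set (J.MultiIdx S)) :
    (J.space S).sectors K ≤ Submodule.span ℂ {z | ∃ k ∈ K, ∃ x : ∀ e : S, (J.sys e).H,
      (∀ e : S, (J.sys e).proj (k e) (x e) = x e) ∧ z = J.pure x} :=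
  PartitionedSpace.sectors_tensor_le _ K

/-- The map `G` in parallel with the identity on the wires in `R`. -/
def parMap {A B R S T : Set Γ.Wire} (hS : IsDisjUnion A R S) (hT : IsDisjUnion B R T)
    (G : (J.space A).H →ₗ[ℂ] (J.space B).H) : (J.space S).H →ₗ[ℂ] (J.space T).H :=
  (J.split hT).symm.toLinearMap ∘ₗ LinearMap.rTensor (J.space R).H G ∘ₗ
    (J.split hS).toLinearMap

/-- The relation `r` in parallel with equality on the indices of the wires in `R`. -/
def parRoute {A B R S T : Set Γ.Wire} (hS : IsDisjUnion A R S) (hT : IsDisjUnion B R T)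
    (r : J.MultiIdx A → J.MultiIdx B → Prop) (k : J.MultiIdx S) (l : J.MultiIdx T) : Prop :=
  r (J.res hS k) (J.res hT l) ∧ J.resRight hS k = J.resRight hT l

variable {A B R S T : Set Γ.Wire} (hS : IsDisjUnion A R S) (hT : IsDisjUnion B R T)

theorem flip_parRoute (r : J.MultiIdx A → J.MultiIdx B → Prop) :
    flip (J.parRoute hS hT r) = J.parRoute hT hS (flip r) := by
  funext l k
  exact propext (and_congr_right fun _ => eq_comm)

theorem parMap_split_symm_tmul (G : (J.space A).H →ₗ[ℂ] (J.space B).H) (a : (J.space A).H)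
    (b : (J.space R).H) :
    J.parMap hS hT G ((J.split hS).symm (a ⊗ₜ b)) = (J.split hT).symm (G a ⊗ₜ b) := by
  simp [parMap]

/-- A linear map on the space of `S = A ⊔ R` can be tested on product vectors. -/
theorem induction_split {S A R : Set Γ.Wire} (h : IsDisjUnion A R S)
    {p : (J.space S).H → Prop} (add : ∀ x y, p x → p y → p (x + y)) (zero : p 0)
    (tmul : ∀ (a : (J.space A).H) (b : (J.space R).H), p ((J.split h).symm (a ⊗ₜ b)))
    (x : (J.space S).H) : p x := by
  rw [← (J.split h).symm_apply_apply x]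
  induction J.split h x using TensorProduct.induction_on with
  | zero => rwa [map_zero]
  | tmul a b => exact tmul a b
  | add x y hx hy => rw [map_add]; exact add _ _ hx hy

theorem adjoint_parMap (G : (J.space A).H →ₗ[ℂ] (J.space B).H) :
    LinearMap.adjoint (J.parMap hS hT G) = J.parMap hT hS (LinearMap.adjoint G) := by
  symm
  rw [LinearMap.eq_adjoint_iff]
  intro y x
  induction x using J.induction_split hS with
  | zero => simp
  | add x x' hx hx' => simp only [map_add, inner_add_right, hx, hx']
  | tmul a b =>
  induction y using J.induction_split hT with
  | zero => simp
  | add x x' hx hx' => simp only [map_add, inner_add_left, hx, hx']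
  | tmul a' b' =>
  rw [parMap_split_symm_tmul, parMap_split_symm_tmul, inner_split_symm_tmul,
    inner_split_symm_tmul, LinearMap.adjoint_inner_left]

/-- Practical isometries are stable under parallel composition with an identity. -/
theorem isPracticalIsometry_parMap {r : J.MultiIdx A → J.MultiIdx B → Prop}
    {G : (J.space A).H →ₗ[ℂ] (J.space B).H}
    (hG : IsPracticalIsometry (J.space A) (J.space B) r G) :
    IsPracticalIsometry (J.space S) (J.space T) (J.parRoute hS hT r) (J.parMap hS hT G) := by
  refine ⟨followsRoute_iff.2 fun k l hkl x => ?_, fun x hx => ?_⟩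
  · induction x using J.induction_split hS with
    | zero => simp
    | add x x' hx hx' => simp only [map_add, hx, hx', add_zero]
    | tmul a b =>
    rw [proj_split_symm_tmul, parMap_split_symm_tmul, proj_split_symm_tmul]
    by_cases hr : r (J.res hS k) (J.res hT l)
    · rw [(J.space R).proj_proj_of_ne fun h => hkl ⟨hr, h.symm⟩, TensorProduct.tmul_zero,
        map_zero]
    · rw [followsRoute_iff.1 hG.1 _ _ hr, TensorProduct.zero_tmul, map_zero]
  · -- The norm is tested on inner products of the pure tensors that span the practical input.
    suffices inner ℂ (J.parMap hS hT G x) (J.parMap hS hT G x) = inner ℂ x x by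
      rw [@norm_eq_sqrt_re_inner ℂ, @norm_eq_sqrt_re_inner ℂ _ _ _ _ x, this]
    have hx' := J.sectors_space_le _ hx
    refine Submodule.span_induction₂
      (p := fun x y _ _ => inner ℂ (J.parMap hS hT G x) (J.parMap hS hT G y) = inner ℂ x y)
      ?_ ?_ ?_ ?_ ?_ ?_ ?_ hx' hx'
    · rintro _ _ ⟨k, ⟨l, hkl⟩, x, hkx, rfl⟩ ⟨k', ⟨l', hkl'⟩, y, hky, rfl⟩
      have mem : ∀ (k : J.MultiIdx S) (l : J.MultiIdx T) (x : ∀ e : S, (J.sys e).H),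
          J.parRoute hS hT r k l → (∀ e : S, (J.sys e).proj (k e) (x e) = x e) →
          J.pure (fun e : A => x ⟨e.1, hS.2.subset (Or.inl e.2)⟩) ∈
            (J.space A).sectors (inputSet r) := by
        intro k l x hkl hx
        have := (J.space A).proj_mem_sectors (S := inputSet r) (k := J.res hS k) ⟨_, hkl.1⟩
          (J.pure fun e : A => x ⟨e.1, hS.2.subset (Or.inl e.2)⟩)
        have hfix : (fun e : A => (J.sys e).proj (J.res hS k e)
            (x ⟨e.1, hS.2.subset (Or.inl e.2)⟩)) =
              fun e : A => x ⟨e.1, hS.2.subset (Or.inl e.2)⟩ :=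
          funext fun e => hx ⟨e.1, hS.2.subset (Or.inl e.2)⟩
        rwa [proj_pure, hfix] at this
      rw [(LinearEquiv.eq_symm_apply (J.split hS)).2 (J.split_pure hS x),
        (LinearEquiv.eq_symm_apply (J.split hS)).2 (J.split_pure hS y), parMap_split_symm_tmul,
        parMap_split_symm_tmul, inner_split_symm_tmul, inner_split_symm_tmul,
        hG.inner_map_map (mem k l x hkl hkx) (mem k' l' y hkl' hky)]
    · intro y _; rw [map_zero, inner_zero_left, inner_zero_left]
    · intro y _; rw [map_zero, inner_zero_right, inner_zero_right]
    · intro x y z _ _ _ h1 h2; simp only [map_add, inner_add_left, h1, h2]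
    · intro x y z _ _ _ h1 h2; simp only [map_add, inner_add_right, h1, h2]
    · intro c x y _ _ h; simp only [map_smul, inner_smul_left, h]
    · intro c x y _ _ h; simp only [map_smul, inner_smul_right, h]

end IODAG.Interpretation

/-! ### Wires, nodes and orders compatible with the graph -/

namespace IODAG

variable {I O : WireSystem.{u}} {Γ : IODAG I O}

theorem eq_of_mem_into {w : Γ.Wire} {n m : Γ.Node} (hn : w ∈ Γ.into n) (hm : w ∈ Γ.into m) :
    n = m := by
  obtain ⟨x, rfl, rfl⟩ := hn
  obtain ⟨y, rfl, hy⟩ := hm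
  rcases x with x | x <;> rcases y with y | y <;> simp_all

theorem eq_of_mem_outof {w : Γ.Wire} {n m : Γ.Node} (hn : w ∈ Γ.outof n) (hm : w ∈ Γ.outof m) :
    n = m := by
  obtain ⟨x, rfl, rfl⟩ := hn
  obtain ⟨y, rfl, hy⟩ := hm
  simp_all

theorem notMem_inputs_of_mem_outof {w : Γ.Wire} {n : Γ.Node} (hn : w ∈ Γ.outof n) :
    w ∉ Γ.inputs := by
  obtain ⟨x, rfl, rfl⟩ := hn
  rintro ⟨i, hi⟩
  simp at hi

theorem notMem_outputs_of_mem_into {w : Γ.Wire} {n : Γ.Node} (hn : w ∈ Γ.into n) :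
    w ∉ Γ.outputs := by
  obtain ⟨x | x, rfl, rfl⟩ := hn <;> rintro ⟨i, hi⟩ <;> simp at hi

theorem mem_outputs_or_mem_into (w : Γ.Wire) : w ∈ Γ.outputs ∨ ∃ n, w ∈ Γ.into n := by
  rcases w with i | e | o
  · exact .inr ⟨_, .inl i, rfl, rfl⟩
  · exact .inr ⟨_, .inr e, rfl, rfl⟩
  · exact .inl ⟨o, rfl⟩

theorem mem_inputs_or_mem_outof (w : Γ.Wire) : w ∈ Γ.inputs ∨ ∃ n, w ∈ Γ.outof n := by
  rcases w with i | e | o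
  · exact .inl ⟨i, rfl⟩
  · exact .inr ⟨_, .inl e, rfl, rfl⟩
  · exact .inr ⟨_, .inr o, rfl, rfl⟩

variable (Γ) in
/-- A wire goes from the node `a` to the node `b`. -/
def Prec (a b : Γ.Node) : Prop := ∃ w, w ∈ Γ.outof a ∧ w ∈ Γ.into b

theorem transGen_prec_irrefl (n : Γ.Node) : ¬ Relation.TransGen Γ.Prec n n := by
  refine fun h => Γ.acyclic n (Relation.TransGen.mono ?_ n n h)
  rintro a b ⟨w, ⟨x, rfl, rfl⟩, ⟨y | y, hy, hxy⟩⟩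
  · simp at hxy
  · rcases x with x | x
    · obtain rfl : y = x := by simpa using hxy
      exact ⟨y, rfl, hy⟩
    · simp at hxy

theorem wellFounded_prec : WellFounded Γ.Prec := by
  have : Std.Irrefl (Relation.TransGen Γ.Prec) := ⟨transGen_prec_irrefl⟩
  exact Subrelation.wf Relation.TransGen.single
    (Finite.wellFounded_of_trans_of_irrefl (Relation.TransGen Γ.Prec))

theorem wellFounded_flip_prec : WellFounded (flip Γ.Prec) := by
  have : Std.Irrefl (flip (Relation.TransGen Γ.Prec)) := ⟨transGen_prec_irrefl⟩
  have : IsTrans _ (flip (Relation.TransGen Γ.Prec)) := ⟨fun _ _ _ h h' => h'.trans h⟩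
  exact Subrelation.wf
    (show ∀ {a b}, flip Γ.Prec a b → flip (Relation.TransGen Γ.Prec) a b from
      fun h => Relation.TransGen.single h)
    (Finite.wellFounded_of_trans_of_irrefl (flip (Relation.TransGen Γ.Prec)))

/-- The set `D` of nodes is closed under predecessors, and `S` consists of the wires that are
available, and not yet consumed, once the nodes in `D` have been used. -/
structure IsFrontier (D : Set Γ.Node) (S : Set Γ.Wire) : Prop where
  mem_iff : ∀ w, w ∈ S ↔ (w ∈ Γ.inputs ∨ ∃ n ∈ D, w ∈ Γ.outof n) ∧ ∀ n ∈ D, w ∉ Γ.into n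
  closed : ∀ n ∈ D, ∀ m, Γ.Prec m n → m ∈ D

theorem isFrontier_empty : IsFrontier ∅ Γ.inputs where
  mem_iff := by simp
  closed := by simp

theorem IsFrontier.insert {D : Set Γ.Node} {R S T : Set Γ.Wire} (h : IsFrontier D S)
    {n : Γ.Node} (hn : n ∉ D) (hS : IsDisjUnion (Γ.into n) R S)
    (hT : IsDisjUnion (Γ.outof n) R T) : IsFrontier (insert n D) T := by
  have hin : ∀ w ∈ Γ.into n, w ∈ S := fun w hw => hS.2.subset (.inl hw)
  have hloop : ∀ w ∈ Γ.outof n, w ∉ Γ.into n := by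
    intro w hw hw'
    rcases ((h.mem_iff w).1 (hin w hw')).1 with hi | ⟨m, hm, hwm⟩
    · exact notMem_inputs_of_mem_outof hw hi
    · exact hn (eq_of_mem_outof hw hwm ▸ hm)
  constructor
  · intro w
    rw [← hT.2]
    constructor
    · rintro (hw | hw)
      · refine ⟨.inr ⟨n, .inl rfl, hw⟩, ?_⟩
        rintro m (rfl | hm) hwm
        · exact hloop w hw hwm
        · exact hn (h.closed m hm n ⟨w, hw, hwm⟩)
      · have hwS := (h.mem_iff w).1 (hS.2.subset (.inr hw))
        refine ⟨hwS.1.imp id fun ⟨m, hm, hwm⟩ => ⟨m, .inr hm, hwm⟩, ?_⟩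
        rintro m (rfl | hm) hwm
        · exact Set.disjoint_left.1 hS.1 hwm hw
        · exact hwS.2 m hm hwm
    · rintro ⟨hw, hw'⟩
      by_cases hwn : w ∈ Γ.outof n
      · exact .inl hwn
      · right
        have hwS : w ∈ S := by
          refine (h.mem_iff w).2 ⟨hw.imp id ?_, fun m hm => hw' m (.inr hm)⟩
          rintro ⟨m, rfl | hm, hwm⟩
          · exact absurd hwm hwn
          · exact ⟨m, hm, hwm⟩
        exact (hS.2.symm.subset hwS).resolve_left (hw' n (.inl rfl))
  · rintro m (rfl | hm) m' hm'
    · obtain ⟨w, hw, hw'⟩ := hm'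
      rcases ((h.mem_iff w).1 (hin w hw')).1 with hi | ⟨p, hp, hwp⟩
      · exact absurd hi (notMem_inputs_of_mem_outof hw)
      · exact .inr (eq_of_mem_outof hw hwp ▸ hp)
    · exact .inr (h.closed m hm m' hm')

/-- Once all nodes have been used, the available wires are the global outputs. -/
theorem IsFrontier.eq_outputs {S : Set Γ.Wire} (h : IsFrontier Set.univ S) : S = Γ.outputs := by
  ext w
  rw [h.mem_iff]
  constructor
  · rintro ⟨-, hw⟩
    exact (mem_outputs_or_mem_into w).resolve_right fun ⟨n, hn⟩ => hw n trivial hn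
  · intro hw
    exact ⟨(mem_inputs_or_mem_outof w).imp id fun ⟨n, hn⟩ => ⟨n, trivial, hn⟩,
      fun n _ hn => notMem_outputs_of_mem_into hn hw⟩

/-- A node all of whose predecessors have been used can be used next. -/
theorem IsFrontier.exists_step {D : Set Γ.Node} {S : Set Γ.Wire} (h : IsFrontier D S)
    {n : Γ.Node} (hn : n ∉ D) (hp : ∀ m, Γ.Prec m n → m ∈ D) :
    ∃ R T, IsDisjUnion (Γ.into n) R S ∧ IsDisjUnion (Γ.outof n) R T := by
  refine ⟨S \ Γ.into n, Γ.outof n ∪ S \ Γ.into n, ⟨Set.disjoint_sdiff_right, ?_⟩, ?_, rfl⟩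
  · refine Set.union_sdiff_cancel fun w hw => (h.mem_iff w).2 ⟨?_, ?_⟩
    · exact (mem_inputs_or_mem_outof w).imp id fun ⟨m, hm⟩ => ⟨m, hp m ⟨w, hm, hw⟩, hm⟩
    · exact fun m hm hwm => hn (eq_of_mem_into hw hwm ▸ hm)
  · rw [Set.disjoint_left]
    rintro w hw ⟨hwS, -⟩
    rcases ((h.mem_iff w).1 hwS).1 with hi | ⟨m, hm, hwm⟩
    · exact notMem_inputs_of_mem_outof hw hi
    · exact hn (eq_of_mem_outof hw hwm ▸ hm)

namespace Interpretation

variable {J : Interpretation.{u, v} Γ}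

theorem Composite.isFrontier {D : Set Γ.Node} {S : Set Γ.Wire}
    {κ : Corel (Γ.IdxOn Γ.inputs) (Γ.IdxOn S)} {F : (J.space Γ.inputs).H →ₗ[ℂ] (J.space S).H}
    (h : J.Composite D S κ F) : IsFrontier D S := by
  induction h with
  | pre => exact isFrontier_empty
  | step _ hn hS hT ih => exact ih.insert hn hS hT

variable (J) in
/-- An order compatible with the graph exists: a maximal set of nodes that can be used is the set
of all nodes. -/
theorem exists_isMeaning : ∃ κ M, J.IsMeaning κ M := by
  obtain ⟨D, hD⟩ := (Set.toFinite {D : Set Γ.Node | ∃ S κ F, J.Composite D S κ F}).exists_maximal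
    ⟨∅, _, _, _, .pre⟩
  obtain ⟨S, κ, F, h⟩ := hD.prop
  have huniv : D = Set.univ := by
    by_contra hne
    obtain ⟨n, hn, hmin⟩ := wellFounded_prec.has_min Dᶜ
      (Set.nonempty_compl.2 hne)
    obtain ⟨R, T, hS, hT⟩ := h.isFrontier.exists_step hn
      fun m hm => by_contra fun hmD => hmin m hmD hm
    exact hn (hD.le_of_ge ⟨_, _, _, h.step hn hS hT⟩ (Set.subset_insert n D) (.inl rfl))
  subst huniv
  obtain rfl := h.isFrontier.eq_outputs
  exact ⟨κ, F, h⟩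

/-- Tracing an index on an available wire backwards leads to a global input, or to a starting
point among the nodes that have been used. -/
theorem Composite.exists_input_or_isStartingPoint {D : Set Γ.Node} {S : Set Γ.Wire}
    {κ : Corel (Γ.IdxOn Γ.inputs) (Γ.IdxOn S)} {F : (J.space Γ.inputs).H →ₗ[ℂ] (J.space S).H}
    (h : J.Composite D S κ F) : ∀ k : Γ.Idx, Γ.place k ∈ S →
      (∃ i : I.Idx, Quotient.mk Γ.rel (.inl i) = Quotient.mk Γ.rel k) ∨
        ∃ n ∈ D, Γ.IsStartingPoint (Quotient.mk Γ.rel k) n := by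
  induction h with
  | pre =>
    rintro (i | e | o) ⟨j, hj⟩
    · exact .inl ⟨i, rfl⟩
    · simp [place] at hj
    · simp [place] at hj
  | @step D S κ F n R T _ hn hS hT ih =>
    have old : ∀ k : Γ.Idx, Γ.place k ∈ S →
        (∃ i : I.Idx, Quotient.mk Γ.rel (.inl i) = Quotient.mk Γ.rel k) ∨
          ∃ m ∈ insert n D, Γ.IsStartingPoint (Quotient.mk Γ.rel k) m := fun k hk =>
      (ih k hk).imp id fun ⟨m, hm, hs⟩ => ⟨m, .inr hm, hs⟩
    intro k hk
    rcases hT.2.symm.subset hk with hk | hk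
    · by_cases hs : Γ.IsStartingPoint (Quotient.mk Γ.rel k) n
      · exact .inr ⟨n, .inl rfl, hs⟩
      · obtain ⟨k', hk', hin⟩ : ∃ k', Quotient.mk Γ.rel k' = Quotient.mk Γ.rel k ∧
            Γ.place k' ∈ Γ.into n := by
          by_contra! hno
          exact hs ⟨⟨k, rfl, hk⟩, hno⟩
        rw [← hk']
        exact old k' (hS.2.subset (.inl hin))
    · exact old k (hS.2.subset (.inr hk))

end Interpretation

/-- Tracing an index forwards leads to a global output, or to an endpoint; this endpoint lies in
every set `U` of nodes that is closed under successors and contains the node that the wire of the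
index enters. -/
theorem exists_output_or_isEndpoint {U : Set Γ.Node} (hU : ∀ n ∈ U, ∀ m, Γ.Prec n m → m ∈ U)
    (k : Γ.Idx) (hk : ∀ n, Γ.place k ∈ Γ.into n → n ∈ U) :
    (∃ o : O.Idx, Quotient.mk Γ.rel (.inr (.inr o)) = Quotient.mk Γ.rel k) ∨
      ∃ n ∈ U, Γ.IsEndpoint (Quotient.mk Γ.rel k) n := by
  have out : ∀ k : Γ.Idx, Γ.place k ∈ Γ.outputs →
      ∃ o : O.Idx, Quotient.mk Γ.rel (.inr (.inr o)) = Quotient.mk Γ.rel k := by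
    rintro (i | e | o) ⟨j, hj⟩
    · simp [place] at hj
    · simp [place] at hj
    · exact ⟨o, rfl⟩
  have main : ∀ n ∈ U, ∀ k : Γ.Idx, Γ.place k ∈ Γ.into n →
      (∃ o : O.Idx, Quotient.mk Γ.rel (.inr (.inr o)) = Quotient.mk Γ.rel k) ∨
        ∃ n ∈ U, Γ.IsEndpoint (Quotient.mk Γ.rel k) n := by
    intro n
    induction n using wellFounded_flip_prec.induction with
    | _ n ih =>
    intro hn k hk
    by_cases he : Γ.IsEndpoint (Quotient.mk Γ.rel k) n
    · exact .inr ⟨n, hn, he⟩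
    · obtain ⟨k', hk', hout⟩ : ∃ k', Quotient.mk Γ.rel k' = Quotient.mk Γ.rel k ∧
          Γ.place k' ∈ Γ.outof n := by
        by_contra! hno
        exact he ⟨⟨k, rfl, hk⟩, hno⟩
      rw [← hk']
      rcases mem_outputs_or_mem_into (Γ.place k') with ho | ⟨m, hm⟩
      · exact .inl (out k' ho)
      · have hnm : Γ.Prec n m := ⟨_, hout, hm⟩
        exact ih m hnm (hU n hn m hnm) k' hm
  rcases mem_outputs_or_mem_into (Γ.place k) with ho | ⟨n, hn⟩
  · exact .inl (out k ho)
  · exact main n (hk n hn) k hn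

end IODAG

/-! ### The composed corelation -/

theorem Corel.bar_comp {A B C : Type u} {κ : Corel A B} {ι : Corel B C} {k : A → ℕ} {l : B → ℕ}
    {m : C → ℕ} (h : κ.bar k l) (h' : ι.bar l m) : (κ.comp ι).bar k m := by
  have key : ∀ x y : A ⊕ B ⊕ C, Relation.EqvGen (Corel.Glue κ ι) x y →
      Sum.elim k (Sum.elim l m) x = Sum.elim k (Sum.elim l m) y := by
    intro x y hxy
    induction hxy with
    | rel x y hxy =>
      rcases hxy with ⟨x, y, hxy⟩ | ⟨x, y, hxy⟩
      · have := h x y hxy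
        rcases x with x | x <;> rcases y with y | y <;> exact this
      · exact h' x y hxy
    | refl => rfl
    | symm _ _ _ ih => exact ih.symm
    | trans _ _ _ _ _ ih ih' => exact ih.trans ih'
  intro x y hxy
  have := key _ _ hxy
  rcases x with x | x <;> rcases y with y | y <;> exact this

namespace IODAG

variable {I O : WireSystem.{u}} {Γ : IODAG I O}

/-- An index placed on a wire in `S`, as an element of `IdxOn S`. -/
def toIdxOn {S : Set Γ.Wire} (k : Γ.Idx) (h : Γ.place k ∈ S) : Γ.IdxOn S :=
  ⟨⟨Γ.place k, h⟩, ⟨k, rfl⟩⟩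

theorem place_mem {S : Set Γ.Wire} (x : Γ.IdxOn S) : Γ.place x.2.1 ∈ S := by
  rw [x.2.2]; exact x.1.2

theorem exists_eq_toIdxOn {S : Set Γ.Wire} (x : Γ.IdxOn S) :
    ∃ (k : Γ.Idx) (h : Γ.place k ∈ S), x = toIdxOn k h := by
  rcases x with ⟨⟨e, he⟩, ⟨k, hk⟩⟩
  change Γ.place k = e at hk
  subst hk
  exact ⟨k, he, rfl⟩

namespace Interpretation

variable {J : Interpretation.{u, v} Γ}

/-- Composing with one more node turns the corelation that the graph induces on the old wires into
the one that it induces on the new wires, if the classes that start at this node are not yet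
present. -/
theorem restrict_comp_stepCorel {R S T : Set Γ.Wire} {n : Γ.Node}
    (hS : IsDisjUnion (Γ.into n) R S) (hT : IsDisjUnion (Γ.outof n) R T)
    (hI : ∀ i : I.Idx, ¬ Γ.IsStartingPoint (Quotient.mk Γ.rel (.inl i)) n)
    (hR : ∀ k : Γ.Idx, Γ.place k ∈ R → ¬ Γ.IsStartingPoint (Quotient.mk Γ.rel k) n) :
    (Γ.restrict Γ.inputs S).comp (Γ.stepCorel R S T) = Γ.restrict Γ.inputs T := by
  have hin : ∀ k : Γ.Idx, Γ.place k ∈ Γ.into n → Γ.place k ∉ R := fun k hk =>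
    Set.disjoint_left.1 hS.1 hk
  have hout : ∀ k : Γ.Idx, Γ.place k ∈ Γ.outof n → Γ.place k ∉ R := fun k hk =>
    Set.disjoint_left.1 hT.1 hk
  let u : Γ.IdxOn Γ.inputs ⊕ Γ.IdxOn S ⊕ Γ.IdxOn T → Γ.Idx :=
    Sum.elim (fun x => x.2.1) (Sum.elim (fun x => x.2.1) (fun x => x.2.1))
  have sound : ∀ x y, Relation.EqvGen
      (Corel.Glue (Γ.restrict Γ.inputs S) (Γ.stepCorel R S T)) x y → Γ.rel (u x) (u y) := by
    intro x y hxy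
    induction hxy with
    | rel x y hxy =>
      rcases hxy with ⟨x, y, hxy⟩ | ⟨x, y, hxy⟩
      · have : Γ.rel (Γ.under x) (Γ.under y) := hxy
        rcases x with x | x <;> rcases y with y | y <;> exact this
      · change Γ.rel (Γ.under x) (Γ.under y)
        rcases hxy with ⟨_, _, h⟩ | ⟨_, h⟩
        · exact h
        · rw [h]
    | refl => exact Γ.rel.refl' _
    | symm _ _ _ ih => exact Γ.rel.symm' ih
    | trans _ _ _ _ _ ih ih' => exact Γ.rel.trans' ih ih'
  -- Every index that remains either leaves `n`, where its class starts, or is connected by the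
  -- gluing to an index that was present before.
  have trace : ∀ z : Γ.IdxOn Γ.inputs ⊕ Γ.IdxOn T,
      (∃ (k : Γ.Idx) (h : Γ.place k ∈ T), z = .inr (toIdxOn k h) ∧ Γ.place k ∈ Γ.outof n ∧
        Γ.IsStartingPoint (Quotient.mk Γ.rel k) n) ∨
      ∃ y : Γ.IdxOn Γ.inputs ⊕ Γ.IdxOn S, Γ.rel (Γ.under z) (Γ.under y) ∧
        ¬ Γ.IsStartingPoint (Quotient.mk Γ.rel (Γ.under y)) n ∧
        Relation.EqvGen (Corel.Glue (Γ.restrict Γ.inputs S) (Γ.stepCorel R S T))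
          (Sum.map id Sum.inr z) (Sum.map id Sum.inl y) := by
    rintro (z | z)
    · refine .inr ⟨.inl z, Γ.rel.refl' _, ?_, .refl _⟩
      obtain ⟨i, hi⟩ : ∃ i, z.2.1 = Sum.inl i := by
        obtain ⟨j, hj⟩ := place_mem z
        rcases h : z.2.1 with i | i | i
        · exact ⟨i, rfl⟩
        · simp [h, place] at hj
        · simp [h, place] at hj
      change ¬ Γ.IsStartingPoint (Quotient.mk Γ.rel z.2.1) n
      rw [hi]
      exact hI i
    · obtain ⟨k, hkT, rfl⟩ := exists_eq_toIdxOn z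
      rcases hT.2.symm.subset hkT with ho | hr
      · by_cases hs : Γ.IsStartingPoint (Quotient.mk Γ.rel k) n
        · exact .inl ⟨k, hkT, rfl, ho, hs⟩
        · obtain ⟨k', hk', hki⟩ : ∃ k', Quotient.mk Γ.rel k' = Quotient.mk Γ.rel k ∧
              Γ.place k' ∈ Γ.into n := by
            by_contra! hno
            exact hs ⟨⟨k, rfl, ho⟩, hno⟩
          have hrel : Γ.rel k k' := Γ.rel.symm' (Quotient.exact hk')
          refine .inr ⟨.inr (toIdxOn k' (hS.2.subset (.inl hki))), hrel, ?_, ?_⟩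
          · change ¬ Γ.IsStartingPoint (Quotient.mk Γ.rel k') n
            rwa [hk']
          · exact .rel _ _ (.right (.inr _) (.inl _) (.inl ⟨hout k ho, hin k' hki, hrel⟩))
      · refine .inr ⟨.inr (toIdxOn k (hS.2.subset (.inr hr))), Γ.rel.refl' _, hR k hr, ?_⟩
        exact .rel _ _ (.right (.inr _) (.inl _) (.inr ⟨hr, rfl⟩))
  ext x y
  constructor
  · intro h
    have := sound _ _ h
    rcases x with x | x <;> rcases y with y | y <;> exact this
  · intro h
    have h : Γ.rel (Γ.under x) (Γ.under y) := h
    change Relation.EqvGen _ (Sum.map id Sum.inr x) (Sum.map id Sum.inr y)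
    rcases trace x with ⟨k, hk, rfl, ho, hs⟩ | ⟨x', hx, hs, gx⟩ <;>
      rcases trace y with ⟨k', hk', rfl, ho', hs'⟩ | ⟨y', hy, hs', gy⟩
    · exact .rel _ _ (.right (.inr _) (.inr _) (.inl ⟨hout k ho, hout k' ho', h⟩))
    · refine absurd ?_ hs'
      rwa [← Quotient.sound (s := Γ.rel) (Γ.rel.trans' h hy)]
    · refine absurd ?_ hs
      rwa [← Quotient.sound (s := Γ.rel) (Γ.rel.trans' (Γ.rel.symm' h) hx)]
    · exact gx.trans _ _ _ (.trans _ _ _ (.rel _ _ (.left _ _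
        (Γ.rel.trans' (Γ.rel.trans' (Γ.rel.symm' hx) h) hy))) (.symm _ _ gy))

/-- In an iso-IODAG, the corelation composed so far is the one induced by the graph. -/
theorem Composite.corel_eq (hΓ : Γ.IsIso) {D : Set Γ.Node} {S : Set Γ.Wire}
    {κ : Corel (Γ.IdxOn Γ.inputs) (Γ.IdxOn S)} {F : (J.space Γ.inputs).H →ₗ[ℂ] (J.space S).H}
    (h : J.Composite D S κ F) : κ = Γ.restrict Γ.inputs S := by
  induction h with
  | pre => rfl
  | @step D S κ F n R T h hn hS hT ih =>
    rw [ih]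
    refine restrict_comp_stepCorel hS hT (fun i => (hΓ _).2 ⟨i, rfl⟩ n) fun k hk hs => ?_
    rcases h.exists_input_or_isStartingPoint k (hS.2.subset (.inr hk)) with hi | ⟨m, hm, hm'⟩
    · exact (hΓ _).2 hi n hs
    · exact hn ((hΓ _).1 n m hs hm' ▸ hm)

/-! ### Consistent families of values -/

variable (J) in
/-- Related indices have equal values. -/
def Consistent {S : Set Γ.Wire} (k : J.MultiIdx S) : Prop :=
  ∀ x y : Γ.IdxOn S, Γ.rel x.2.1 y.2.1 → (k x.1 x.2 : ℕ) = k y.1 y.2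

/-- A consistent family of values on some wires extends to all wires. -/
theorem Consistent.exists_extension {S : Set Γ.Wire} {k : J.MultiIdx S} (hk : J.Consistent k) :
    ∃ a : ∀ i : Γ.Idx, Fin (J.length i), (∀ i j, Γ.rel i j → (a i : ℕ) = a j) ∧
      ∀ (e : S) (i : Γ.IdxAt e), a i = k e i := by
  classical
  -- Classes that are not present in `S` get the value `0`; it exists because lengths are positive.
  let a : ∀ i : Γ.Idx, Fin (J.length i) := fun i =>
    if h : ∃ x : Γ.IdxOn S, Γ.rel x.2.1 i then
      ⟨k h.choose.1 h.choose.2, J.length_rel _ _ h.choose_spec ▸ (k h.choose.1 h.choose.2).2⟩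
    else ⟨0, J.length_pos i⟩
  have ha : ∀ i (x : Γ.IdxOn S), Γ.rel x.2.1 i → (a i : ℕ) = k x.1 x.2 := by
    intro i x hx
    have h : ∃ x : Γ.IdxOn S, Γ.rel x.2.1 i := ⟨x, hx⟩
    simp only [a, dif_pos h]
    exact hk _ _ (Γ.rel.trans' h.choose_spec (Γ.rel.symm' hx))
  refine ⟨a, fun i j hij => ?_, fun e i => Fin.ext (ha i ⟨e, i⟩ (Γ.rel.refl' _))⟩
  by_cases h : ∃ x : Γ.IdxOn S, Γ.rel x.2.1 i
  · obtain ⟨x, hx⟩ := h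
    rw [ha i x hx, ha j x (Γ.rel.trans' hx hij)]
  · have h' : ¬ ∃ x : Γ.IdxOn S, Γ.rel x.2.1 j :=
      fun ⟨x, hx⟩ => h ⟨x, Γ.rel.trans' hx (Γ.rel.symm' hij)⟩
    simp only [a, dif_neg h, dif_neg h']

theorem Consistent.exists_route {S : Set Γ.Wire} {k : J.MultiIdx S} (hk : J.Consistent k)
    (T : Set Γ.Wire) : ∃ l, J.route (Γ.restrict S T) k l := by
  obtain ⟨a, ha, hak⟩ := hk.exists_extension
  refine ⟨fun e i => a i, fun x y hxy => ?_⟩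
  have h := ha _ _ hxy
  rcases x with x | x <;> rcases y with y | y <;> simpa only [Sum.elim_inl, Sum.elim_inr, ← hak]

theorem flip_route_restrict (S T : Set Γ.Wire) :
    flip (J.route (Γ.restrict S T)) = J.route (Γ.restrict T S) := by
  have key : ∀ (S T : Set Γ.Wire) k l, J.route (Γ.restrict S T) k l →
      J.route (Γ.restrict T S) l k := by
    intro S T k l h x y hxy
    have := h x.swap y.swap (by rcases x with x | x <;> rcases y with y | y <;> exact hxy)
    rcases x with x | x <;> rcases y with y | y <;> exact this
  funext l k
  exact propext ⟨key _ _ _ _, key _ _ _ _⟩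

theorem consistent_left_of_route {S T : Set Γ.Wire} {k : J.MultiIdx S} {l : J.MultiIdx T}
    (h : J.route (Γ.restrict S T) k l) : J.Consistent k :=
  fun x y hxy => h (.inl x) (.inl y) hxy

theorem consistent_right_of_route {S T : Set Γ.Wire} {k : J.MultiIdx S} {l : J.MultiIdx T}
    (h : J.route (Γ.restrict S T) k l) : J.Consistent l :=
  fun x y hxy => h (.inr x) (.inr y) hxy

theorem inputSet_route_restrict (S T : Set Γ.Wire) :
    inputSet (J.route (Γ.restrict S T)) = {k | J.Consistent k} :=
  Set.ext fun _ => ⟨fun ⟨_, h⟩ => consistent_left_of_route h, fun h => h.exists_route T⟩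

theorem inputSet_flip_route_restrict (S T : Set Γ.Wire) :
    inputSet (flip (J.route (Γ.restrict S T))) = {k | J.Consistent k} := by
  rw [flip_route_restrict, inputSet_route_restrict]

/-- An index and its copy on the other side are related by the pre-processing corelation. -/
theorem route_preCorel_iff (k l : J.MultiIdx Γ.inputs) :
    J.route Γ.preCorel k l ↔ k = l ∧ J.route Γ.preCorel k k := by
  constructor
  · intro h
    have hkl : k = l := funext fun e => funext fun i =>
      Fin.ext (h (.inl ⟨e, i⟩) (.inr ⟨e, i⟩) (Γ.rel.refl' _))
    exact ⟨hkl, by subst hkl; exact h⟩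
  · rintro ⟨rfl, h⟩
    exact h

theorem route_stepCorel_of_restrict {R S T : Set Γ.Wire} {k : J.MultiIdx S} {l : J.MultiIdx T}
    (h : J.route (Γ.restrict S T) k l) : J.route (Γ.stepCorel R S T) k l := by
  rintro x y (⟨_, _, hxy⟩ | ⟨_, hxy⟩)
  · exact h x y hxy
  · refine h x y ?_
    change Γ.rel (Γ.under x) (Γ.under y)
    rw [hxy]

variable {R S T : Set Γ.Wire} {n : Γ.Node}

/-- The route of a step is the route of the node in parallel with equality. -/
theorem route_stepCorel (hS : IsDisjUnion (Γ.into n) R S) (hT : IsDisjUnion (Γ.outof n) R T) :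
    J.route (Γ.stepCorel R S T) = J.parRoute hS hT (J.route (Γ.nodeCorel n)) := by
  funext k l
  refine propext ⟨fun h => ⟨fun x y hxy => ?_, funext fun e => funext fun i => Fin.ext ?_⟩,
    fun h => ?_⟩
  · let g : Γ.IdxOn (Γ.into n) ⊕ Γ.IdxOn (Γ.outof n) → Γ.IdxOn S ⊕ Γ.IdxOn T :=
      Sum.map (fun x => ⟨⟨x.1.1, hS.2.subset (.inl x.1.2)⟩, x.2⟩)
        (fun x => ⟨⟨x.1.1, hT.2.subset (.inl x.1.2)⟩, x.2⟩)
    have hg : ∀ x, Γ.under (g x) = Γ.under x ∧ Γ.place (Γ.under (g x)) ∉ R := by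
      rintro (x | x)
      · exact ⟨rfl, Set.disjoint_left.1 hS.1 (place_mem x)⟩
      · exact ⟨rfl, Set.disjoint_left.1 hT.1 (place_mem x)⟩
    have := h (g x) (g y) (.inl ⟨(hg x).2, (hg y).2, by rw [(hg x).1, (hg y).1]; exact hxy⟩)
    rcases x with x | x <;> rcases y with y | y <;> exact this
  · exact h (.inl ⟨⟨e.1, hS.2.subset (.inr e.2)⟩, i⟩) (.inr ⟨⟨e.1, hT.2.subset (.inr e.2)⟩, i⟩)
      (.inr ⟨place_mem ⟨e, i⟩, rfl⟩)
  · have hnode : ∀ x : Γ.IdxOn S ⊕ Γ.IdxOn T, Γ.place (Γ.under x) ∉ R →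
        ∃ x' : Γ.IdxOn (Γ.into n) ⊕ Γ.IdxOn (Γ.outof n), Γ.under x' = Γ.under x ∧
          Sum.elim (fun x => (J.res hS k x.1 x.2 : ℕ)) (fun x => (J.res hT l x.1 x.2 : ℕ)) x' =
          Sum.elim (fun x => (k x.1 x.2 : ℕ)) (fun x => (l x.1 x.2 : ℕ)) x := by
      rintro (x | x) hx <;> obtain ⟨i, he, rfl⟩ := exists_eq_toIdxOn x
      · exact ⟨.inl (toIdxOn i ((hS.2.symm.subset he).resolve_right hx)), rfl, rfl⟩
      · exact ⟨.inr (toIdxOn i ((hT.2.symm.subset he).resolve_right hx)), rfl, rfl⟩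
    have hrest : ∀ x : Γ.IdxOn S ⊕ Γ.IdxOn T, ∀ (i : Γ.Idx) (hi : Γ.place i ∈ R),
        Γ.under x = i → (J.resRight hS k ⟨_, hi⟩ ⟨i, rfl⟩ : ℕ) =
          Sum.elim (fun x => (k x.1 x.2 : ℕ)) (fun x => (l x.1 x.2 : ℕ)) x := by
      rintro (x | x) _ hx rfl <;> obtain ⟨i, he, rfl⟩ := exists_eq_toIdxOn x
      · rfl
      · rw [h.2]; rfl
    rintro x y (⟨hx, hy, hxy⟩ | ⟨hx, hxy⟩)
    · obtain ⟨x', hx', hvx⟩ := hnode x hx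
      obtain ⟨y', hy', hvy⟩ := hnode y hy
      rw [← hvx, ← hvy]
      refine h.1 x' y' ?_
      change Γ.rel (Γ.under x') (Γ.under y')
      rwa [hx', hy']
    · rw [← hrest x _ hx rfl, ← hrest y _ hx hxy.symm]

/-- If one input of a step is consistent, then so are all inputs with a common output, provided
that the classes that end at the node are absent from the other wires. -/
theorem Consistent.of_route_stepCorel (hS : IsDisjUnion (Γ.into n) R S)
    (hT : IsDisjUnion (Γ.outof n) R T)
    (hR : ∀ k : Γ.Idx, Γ.place k ∈ R → ¬ Γ.IsEndpoint (Quotient.mk Γ.rel k) n)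
    {l l' : J.MultiIdx S} {m : J.MultiIdx T} (hl : J.Consistent l)
    (h : J.route (Γ.stepCorel R S T) l m) (h' : J.route (Γ.stepCorel R S T) l' m) :
    J.Consistent l' := by
  have hin : ∀ k : Γ.Idx, Γ.place k ∈ Γ.into n → Γ.place k ∉ R := fun k hk =>
    Set.disjoint_left.1 hS.1 hk
  -- The two inputs agree on every index whose class does not end at the node.
  have agree : ∀ x : Γ.IdxOn S, ¬ Γ.IsEndpoint (Quotient.mk Γ.rel x.2.1) n →
      (l' x.1 x.2 : ℕ) = l x.1 x.2 := by
    intro x hx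
    rcases hS.2.symm.subset (place_mem x) with hi | hr
    · obtain ⟨k, hk, hko⟩ : ∃ k', Quotient.mk Γ.rel k' = Quotient.mk Γ.rel x.2.1 ∧
          Γ.place k' ∈ Γ.outof n := by
        by_contra! hno
        exact hx ⟨⟨x.2.1, rfl, hi⟩, hno⟩
      have hxk : Γ.stepCorel R S T (.inl x) (.inr (toIdxOn k (hT.2.subset (.inl hko)))) :=
        .inl ⟨hin _ hi, Set.disjoint_left.1 hT.1 hko, Γ.rel.symm' (Quotient.exact hk)⟩
      exact (h' _ _ hxk).trans (h _ _ hxk).symm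
    · have hxk : Γ.stepCorel R S T (.inl x) (.inr (toIdxOn x.2.1 (hT.2.subset (.inr hr)))) :=
        .inr ⟨hr, rfl⟩
      exact (h' _ _ hxk).trans (h _ _ hxk).symm
  intro x y hxy
  have hq : Quotient.mk Γ.rel x.2.1 = Quotient.mk Γ.rel y.2.1 := Quotient.sound hxy
  by_cases he : Γ.IsEndpoint (Quotient.mk Γ.rel x.2.1) n
  · exact h' (.inl x) (.inl y) (.inl ⟨fun hr => hR _ hr he, fun hr => hR _ hr (hq ▸ he), hxy⟩)
  · rw [agree x he, agree y (hq ▸ he), hl x y hxy]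

/-! ### Properness and practical isometries -/

/-- Every family of values reached along a route induced by the graph is consistent, hence is an
input of the next step. -/
theorem properForIsometries_restrict (U R S T : Set Γ.Wire) :
    ProperForIsometries (J.route (Γ.restrict U S)) (J.route (Γ.stepCorel R S T)) := by
  rintro l - l' ⟨k, -, h⟩
  obtain ⟨m, hm⟩ := (consistent_right_of_route h).exists_route T
  exact ⟨m, route_stepCorel_of_restrict hm⟩

/-- In a uni-IODAG, a class that ends at the next node is absent from the wires that do not enter
this node. -/
theorem Composite.not_isEndpoint (hΓ : Γ.IsUni) {D : Set Γ.Node}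
    {κ : Corel (Γ.IdxOn Γ.inputs) (Γ.IdxOn S)} {F : (J.space Γ.inputs).H →ₗ[ℂ] (J.space S).H}
    (h : J.Composite D S κ F) (hn : n ∉ D) (hS : IsDisjUnion (Γ.into n) R S)
    (hT : IsDisjUnion (Γ.outof n) R T) (k : Γ.Idx) (hk : Γ.place k ∈ R) :
    ¬ Γ.IsEndpoint (Quotient.mk Γ.rel k) n := by
  intro he
  have hf := (h.step hn hS hT).isFrontier
  rcases exists_output_or_isEndpoint (U := (insert n D)ᶜ)
    (fun p hp q hpq hq => hp (hf.closed q hq p hpq)) k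
    (fun p hp hpD => ((hf.mem_iff _).1 (hT.2.subset (.inr hk))).2 p hpD hp) with ho | ⟨p, hp, hp'⟩
  · exact (hΓ.2 _).2 ho n he
  · exact hp (.inl ((hΓ.2 _).1 p n hp' he))

theorem Composite.properForUnitaries (hΓ : Γ.IsUni) {D : Set Γ.Node}
    {κ : Corel (Γ.IdxOn Γ.inputs) (Γ.IdxOn S)} {F : (J.space Γ.inputs).H →ₗ[ℂ] (J.space S).H}
    (h : J.Composite D S κ F) (hn : n ∉ D) (hS : IsDisjUnion (Γ.into n) R S)
    (hT : IsDisjUnion (Γ.outof n) R T) :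
    ProperForUnitaries (J.route κ) (J.route (Γ.stepCorel R S T)) := by
  rw [h.corel_eq hΓ.1]
  refine ⟨properForIsometries_restrict _ _ _ _, ?_⟩
  unfold ProperForIsometries
  rw [inputSet_flip_route_restrict]
  rintro l hl l' ⟨m, hm, hm'⟩
  exact Consistent.of_route_stepCorel hS hT (h.not_isEndpoint hΓ hn hS hT) hl hm hm'

theorem isPracticalIsometry_stepMap (hS : IsDisjUnion (Γ.into n) R S)
    (hT : IsDisjUnion (Γ.outof n) R T)
    (h : IsPracticalIsometry (J.space (Γ.into n)) (J.space (Γ.outof n))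
      (J.route (Γ.nodeCorel n)) (J.morph n)) :
    IsPracticalIsometry (J.space S) (J.space T) (J.route (Γ.stepCorel R S T))
      (J.stepMap hS hT) := by
  rw [route_stepCorel hS hT]
  exact J.isPracticalIsometry_parMap hS hT h

theorem isPracticalIsometry_adjoint_stepMap (hS : IsDisjUnion (Γ.into n) R S)
    (hT : IsDisjUnion (Γ.outof n) R T)
    (h : IsPracticalIsometry (J.space (Γ.outof n)) (J.space (Γ.into n))
      (flip (J.route (Γ.nodeCorel n))) (LinearMap.adjoint (J.morph n))) :
    IsPracticalIsometry (J.space T) (J.space S) (flip (J.route (Γ.stepCorel R S T)))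
      (LinearMap.adjoint (J.stepMap hS hT)) := by
  have hadj : LinearMap.adjoint (J.stepMap hS hT) =
      J.parMap hT hS (LinearMap.adjoint (J.morph n)) := J.adjoint_parMap hS hT (J.morph n)
  rw [route_stepCorel hS hT, flip_parRoute, hadj]
  exact J.isPracticalIsometry_parMap hT hS h

theorem isPracticalIsometry_preMap :
    IsPracticalIsometry (J.space Γ.inputs) (J.space Γ.inputs) (J.route Γ.preCorel) J.preMap :=
  isPracticalIsometry_sum_proj _ (S := {k | J.route Γ.preCorel k k}) route_preCorel_iff

theorem adjoint_preMap : LinearMap.adjoint J.preMap = J.preMap :=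
  adjoint_sum_proj _ {k | J.route Γ.preCorel k k}

theorem Composite.isPracticalIsometry (hΓ : Γ.IsIso) (hJ : J.IsPracticallyIsometric)
    {D : Set Γ.Node} {κ : Corel (Γ.IdxOn Γ.inputs) (Γ.IdxOn S)}
    {F : (J.space Γ.inputs).H →ₗ[ℂ] (J.space S).H} (h : J.Composite D S κ F) :
    IsPracticalIsometry (J.space Γ.inputs) (J.space S) (J.route κ) F := by
  induction h with
  | pre => exact isPracticalIsometry_preMap
  | @step D S κ F n R T h hn hS hT ih =>
    have hstep := isPracticalIsometry_stepMap hS hT (hJ n)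
    have hκ := h.corel_eq hΓ
    have hκ' := (h.step hn hS hT).corel_eq hΓ
    refine ih.comp hstep (fun k l m => Corel.bar_comp) ?_ ?_
    · rw [hκ', hκ, inputSet_route_restrict, inputSet_route_restrict]
    · rw [hκ]
      intro k _ l hkl
      obtain ⟨m, hm⟩ := (consistent_right_of_route hkl).exists_route T
      exact ⟨m, route_stepCorel_of_restrict hm⟩

/-- The composition is read backwards: the adjoint of the last step comes first. -/
theorem Composite.isPracticalIsometry_adjoint (hΓ : Γ.IsUni) (hJ : J.IsPracticallyUnitary)
    {D : Set Γ.Node} {κ : Corel (Γ.IdxOn Γ.inputs) (Γ.IdxOn S)}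
    {F : (J.space Γ.inputs).H →ₗ[ℂ] (J.space S).H} (h : J.Composite D S κ F) :
    IsPracticalIsometry (J.space S) (J.space Γ.inputs) (flip (J.route κ))
      (LinearMap.adjoint F) := by
  induction h with
  | pre =>
    rw [adjoint_preMap, flip_route_restrict]
    exact isPracticalIsometry_preMap
  | @step D S κ F n R T h hn hS hT ih =>
    have hstep := isPracticalIsometry_adjoint_stepMap hS hT (hJ n).2
    have hκ := h.corel_eq hΓ.1
    have hκ' := (h.step hn hS hT).corel_eq hΓ.1
    -- A consistent output of the step comes from a consistent input.
    have hback : ∀ m : J.MultiIdx T, J.Consistent m →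
        ∃ l, J.Consistent l ∧ J.route (Γ.stepCorel R S T) l m := by
      intro m hm
      obtain ⟨l, hl⟩ := hm.exists_route S
      rw [← flip_route_restrict] at hl
      exact ⟨l, consistent_left_of_route hl, route_stepCorel_of_restrict hl⟩
    rw [LinearMap.adjoint_comp]
    refine hstep.comp ih (fun m l k hlm hkl => Corel.bar_comp hkl hlm) ?_ ?_
    · rw [hκ', inputSet_flip_route_restrict]
      intro m hm
      obtain ⟨l, -, hl⟩ := hback m hm
      exact ⟨l, hl⟩
    · rw [hκ', hκ, inputSet_flip_route_restrict, inputSet_flip_route_restrict]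
      intro m hm l hlm
      obtain ⟨l₀, hl₀, hl₀m⟩ := hback m hm
      exact Consistent.of_route_stepCorel hS hT (h.not_isEndpoint hΓ hn hS hT) hl₀ hl₀m hlm

end Interpretation

end IODAG

end

theorem mainTheorem8 {I O : WireSystem.{u}} (Γ : IODAG I O)
    (J : IODAG.Interpretation.{u, v} Γ) :
    (∃ κ M, J.IsMeaning κ M) ∧
    (Γ.IsIso →
      (∀ D S κ F, J.Composite D S κ F → ∀ n ∉ D, ∀ R T, IODAG.IsDisjUnion (Γ.into n) R S →
        IODAG.IsDisjUnion (Γ.outof n) R T →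
          ProperForIsometries (J.route κ) (J.route (Γ.stepCorel R S T))) ∧
      ∀ κ M, J.IsMeaning κ M → κ = Γ.totCorel ∧
        (J.IsPracticallyIsometric →
          IsPracticalIsometry (J.space Γ.inputs) (J.space Γ.outputs) (J.route κ) M)) ∧
    (Γ.IsUni →
      (∀ D S κ F, J.Composite D S κ F → ∀ n ∉ D, ∀ R T, IODAG.IsDisjUnion (Γ.into n) R S →
        IODAG.IsDisjUnion (Γ.outof n) R T →
          ProperForUnitaries (J.route κ) (J.route (Γ.stepCorel R S T))) ∧
      ∀ κ M, J.IsMeaning κ M → κ = Γ.totCorel ∧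
        (J.IsPracticallyUnitary →
          IsPracticalUnitary (J.space Γ.inputs) (J.space Γ.outputs) (J.route κ) M)) := by
  refine ⟨J.exists_isMeaning, fun hΓ => ⟨?_, fun κ M h => ⟨h.corel_eq hΓ, fun hJ =>
    h.isPracticalIsometry hΓ hJ⟩⟩, fun hΓ => ⟨?_, fun κ M h => ⟨h.corel_eq hΓ.1, fun hJ =>
      ⟨h.isPracticalIsometry hΓ.1 fun n => (hJ n).1, h.isPracticalIsometry_adjoint hΓ hJ⟩⟩⟩⟩
  · intro D S κ F h n _ R T _ _
    rw [h.corel_eq hΓ]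
    exact IODAG.Interpretation.properForIsometries_restrict _ _ _ _
  · intro D S κ F h n hn R T hS hT
    exact h.properForUnitaries hΓ hn hS hT
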